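/- Let $G=(V,E)$ be a finite connected simple graph with at least two vertices and edge-weights $w_e>0$, $e\in E$. Consider the multigraph-valued process $(Z_t)_{t\ge 0}$ on the vertex set $V$ that starts with no edges and in which copies of each edge $e\in E$ arrive at the times of a Poisson process of rate $w_e$, independently over $e\in E$. Different copies of the same edge $e$ are regarded as different (hence disjoint) edges. For an integer $k\ge 1$ let $$T^{\mathrm{span}}_k=\inf\{t\ge 0: Z_t \text{ contains } k \text{ edge-disjoint spanning trees}\},\qquad T^{\mathrm{tria}}_k=\inf\{t\ge 0: Z_t \text{ contains } k \text{ edge-disjoint triangles}\}.$$ Then, for every $k\ge 1$, the time $T^{\mathrm{span}}_k$ is almost surely finite, has a finite second moment and a strictly positive mean, and $$\frac{\mathrm{s.d.}(T^{\mathrm{span}}_k)}{\mathbb{E}\,T^{\mathrm{span}}_k}\le\frac{1}{\sqrt{k}}.$$ If moreover $G$ contains a triangle, then, for every $k\ge 1$, the time $T^{\mathrm{tria}}_k$ is almost surely finite, has a finite second moment and a strictly positive mean, and $$\frac{\mathrm{s.d.}(T^{\mathrm{tria}}_k)}{\mathbb{E}\,T^{\mathrm{tria}}_k}\le\left(\frac{e}{e-1}\right)^{1/2}k^{-1/6}\qquad(\text{here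 } e=\exp(1)).$$ -/

import Mathlib

open MeasureTheory ProbabilityTheory
open scoped NNReal ENNReal

namespace MultigraphProcess

/-- `N` is a (homogeneous) Poisson counting process of rate `r` under `μ`: almost surely its paths
start at `0`, are nondecreasing and right-continuous; its increments are independent, and the
increment over `(s, t]` is Poisson distributed with mean `r * (t - s)`. -/
structure IsPoissonProcess {Ω : Type*} [MeasurableSpace Ω] (N : ℝ≥0 → Ω → ℕ) (r : ℝ≥0)
    (μ : Measure Ω) : Prop where
  measurable : ∀ t, Measurable (N t)
  zero : ∀ᵐ ω ∂μ, N 0 ω = 0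
  mono : ∀ᵐ ω ∂μ, Monotone fun t => N t ω
  rightCont : ∀ᵐ ω ∂μ, ∀ t, ContinuousWithinAt (fun s => N s ω) (Set.Ici t) t
  indepIncrements : HasIndepIncrements N μ
  incrementLaw : ∀ s t, s ≤ t → HasLaw (N t - N s) (poissonMeasure (r * (t - s))) μ

/-- `N e t` is the number of copies of the edge `e` of `G` that have arrived by time `t`: the copies
of `e` arrive as a Poisson process of rate `w e`, and these processes are independent over `e`. -/
structure IsMultigraphProcess {V Ω : Type*} [MeasurableSpace Ω] (G : SimpleGraph V)
    (w : G.edgeSet → ℝ≥0) (N : G.edgeSet → ℝ≥0 → Ω → ℕ) (μ : Measure Ω) : Prop where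
  poisson : ∀ e, IsPoissonProcess (N e) (w e) μ
  indep : iIndepFun (fun e ω t => N e t ω) μ

/-- The edges of the multigraph with `m e` distinct copies of each edge `e` of `G`. -/
abbrev EdgeCopy {V : Type*} {G : SimpleGraph V} (m : G.edgeSet → ℕ) : Type _ :=
  Σ e : G.edgeSet, Fin (m e)

/-- The set of vertex pairs joined by some edge of `F`. -/
def support {V : Type*} {G : SimpleGraph V} {m : G.edgeSet → ℕ} (F : Set (EdgeCopy m)) :
    Set (Sym2 V) :=
  (fun c => (c.1 : Sym2 V)) '' F

/-- A set `F` of edges of the multigraph is (the edge set of) a spanning tree: it has no two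
parallel edges, and the simple graph on all of `V` that it forms is a tree. -/
def IsSpanningTree {V : Type*} {G : SimpleGraph V} {m : G.edgeSet → ℕ}
    (F : Set (EdgeCopy m)) : Prop :=
  Set.InjOn Sigma.fst F ∧ (SimpleGraph.fromEdgeSet (support F)).IsTree

/-- A set `F` of edges of the multigraph is (the edge set of) a triangle: it has no two parallel
edges, and it joins exactly the three pairs from some three distinct vertices. -/
def IsTriangle {V : Type*} {G : SimpleGraph V} {m : G.edgeSet → ℕ}
    (F : Set (EdgeCopy m)) : Prop :=
  Set.InjOn Sigma.fst F ∧
    ∃ a b c : V, a ≠ b ∧ b ≠ c ∧ a ≠ c ∧ support F = {s(a, b), s(b, c), s(a, c)}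

/-- The multigraph `m` contains `k` edge-disjoint spanning trees. -/
def ContainsSpanningTrees {V : Type*} {G : SimpleGraph V} (k : ℕ) (m : G.edgeSet → ℕ) : Prop :=
  ∃ F : Fin k → Set (EdgeCopy m),
    (∀ i j, i ≠ j → Disjoint (F i) (F j)) ∧ ∀ i, IsSpanningTree (F i)

/-- The multigraph `m` contains `k` edge-disjoint triangles. -/
def ContainsTriangles {V : Type*} {G : SimpleGraph V} (k : ℕ) (m : G.edgeSet → ℕ) : Prop :=
  ∃ F : Fin k → Set (EdgeCopy m),
    (∀ i j, i ≠ j → Disjoint (F i) (F j)) ∧ ∀ i, IsTriangle (F i)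

/-- The infimum of the times `t` at which the multigraph has the property `P` (`∞` if there is no
such time). -/
noncomputable def hittingTime {V Ω : Type*} {G : SimpleGraph V} (P : (G.edgeSet → ℕ) → Prop)
    (N : G.edgeSet → ℝ≥0 → Ω → ℕ) (ω : Ω) : ℝ≥0∞ :=
  ⨅ (t : ℝ≥0) (_ : P fun e => N e t ω), (t : ℝ≥0∞)

/-- The first time to contain `k` edge-disjoint spanning trees. -/
noncomputable def spanTime {V Ω : Type*} {G : SimpleGraph V} (k : ℕ)
    (N : G.edgeSet → ℝ≥0 → Ω → ℕ) : Ω → ℝ≥0∞ :=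
  hittingTime (ContainsSpanningTrees k) N

/-- The first time to contain `k` edge-disjoint triangles. -/
noncomputable def triaTime {V Ω : Type*} {G : SimpleGraph V} (k : ℕ)
    (N : G.edgeSet → ℝ≥0 → Ω → ℕ) : Ω → ℝ≥0∞ :=
  hittingTime (ContainsTriangles k) N

/-- The expectation of a random time (used for almost surely finite, integrable times). -/
noncomputable def mean {Ω : Type*} [MeasurableSpace Ω] (T : Ω → ℝ≥0∞) (μ : Measure Ω) : ℝ :=
  ∫ ω, (T ω).toReal ∂μ

/-- The standard deviation of a random time (used for almost surely finite, square-integrable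
times). -/
noncomputable def stdDev {Ω : Type*} [MeasurableSpace Ω] (T : Ω → ℝ≥0∞) (μ : Measure Ω) : ℝ :=
  √(variance (fun ω => (T ω).toReal) μ)

end MultigraphProcess

set_option linter.unusedSectionVars false

/-! The multiplicities form a Markov chain on `E → ℕ`, and each time is the hitting time of an
increasing set `A`. Let `h m` be the mean remaining time from state `m`: it vanishes on `A` and
solves `gen w h = -1` off it. The second moment `g` solves `gen w g = -2h`. If one arrival never
lowers `h` by more than `κ`, then each squared drop is at most `κ` times the drop, and the maximum
principle gives variance ≤ `κ * h 0` (`IsSolution.variance_le`). So the squared coefficient of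
variation is at most `κ / h 0`.

The drop `h m - h (addEdge m e)` is harmonic until the extra copy completes the target, so `κ` need
only bound `h` at states one arrival short of `A` (`IsSolution.sub_addEdge_le`).

Spanning trees: at such a state, removing the missing edge from its tree leaves a cut `C`, and any
arrival across `C` finishes, so `h m ≤ 1 / w(C)`. But `k` disjoint trees need `k` arrivals across
`C`, so `h 0 ≥ k / w(C)`. Hence `κ = h 0 / k` works (`sub_addEdge_le_of_exchange`).

Triangles: one arrival short, `k - 1` disjoint triangles are already present, so `κ` can be the mean
time `h₁ 0` to a first triangle (`sub_addEdge_le_solution_one`). To compare `h₁ 0` with `h 0`, keep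
each arrival with probability `p = k ^ (-1/3)`. The kept process is the original slowed by the
factor `p`, and when `k` disjoint triangles exist, one survives whole with probability at least `1 -
(1 - 1/k)^k ≥ 1 - 1/e`. This gives `(1 - 1/e) * h₁ 0 ≤ p * h 0` (`mul_solution_one_le`).

Multiplicities above a bound `K` never matter, so the equations are solved by finite recursion. The
forward equation for truncated Poisson variables then identifies `h 0` and `g 0` with the moments of
the actual hitting time (`IsSolution.moments`). -/

namespace MultigraphProcess

/-! ### Generator, maximum principle and first-step equations -/

section Generator

variable {E : Type*} [Fintype E] [DecidableEq E]

/-- The state `m` with one more copy of `e`. -/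
def addEdge (m : E → ℕ) (e : E) : E → ℕ := m + Pi.single e 1

theorem addEdge_self (m : E → ℕ) (e : E) : addEdge m e e = m e + 1 := by simp [addEdge]

theorem addEdge_of_ne (m : E → ℕ) {e e' : E} (h : e' ≠ e) : addEdge m e e' = m e' := by
  simp [addEdge, h]

theorem le_addEdge (m : E → ℕ) (e : E) : m ≤ addEdge m e := by
  simp [addEdge]

theorem addEdge_comm (m : E → ℕ) (e e' : E) :
    addEdge (addEdge m e) e' = addEdge (addEdge m e') e := by
  simp [addEdge, add_right_comm]

theorem addEdge_add (m n : E → ℕ) (e : E) : addEdge (m + n) e = m + addEdge n e := by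
  simp [addEdge, add_assoc]

theorem exists_eq_addEdge {m : E → ℕ} {e : E} (h : m e ≠ 0) : ∃ m', m = addEdge m' e := by
  refine ⟨Function.update m e (m e - 1), ?_⟩
  funext x
  by_cases hx : x = e
  · subst hx
    rw [addEdge_self, Function.update_self]
    omega
  · rw [addEdge_of_ne _ hx, Function.update_of_ne hx]

/-- The generator of the chain that adds a copy of `e` at rate `w e`. -/
def gen (w : E → ℝ) (φ : (E → ℕ) → ℝ) (m : E → ℕ) : ℝ :=
  ∑ e, w e * (φ (addEdge m e) - φ m)

/-- The number of arrivals that are missing to have `K` copies of every edge. -/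
def deficit (K : ℕ) (m : E → ℕ) : ℕ := ∑ e, (K - m e)

theorem deficit_addEdge {K : ℕ} {m : E → ℕ} {e : E} (h : m e < K) :
    deficit K (addEdge m e) + 1 = deficit K m := by
  unfold deficit
  rw [← Finset.add_sum_erase _ _ (Finset.mem_univ e), ← Finset.add_sum_erase _ _ (Finset.mem_univ e),
    addEdge_self]
  have : ∑ x ∈ Finset.univ.erase e, (K - addEdge m e x) = ∑ x ∈ Finset.univ.erase e, (K - m x) :=
    Finset.sum_congr rfl fun x hx => by rw [addEdge_of_ne m (Finset.ne_of_mem_erase hx)]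
  omega

/-- The state with all multiplicities cut down to at most `K`. -/
def trunc (K : ℕ) (m : E → ℕ) : E → ℕ := fun e => min (m e) K

/-- `A` is an increasing set of states that depends only on the multiplicities cut down to `K` and
contains the state in which all of these are `K`. -/
structure IsTarget (K : ℕ) (A : Set (E → ℕ)) : Prop where
  upper : IsUpperSet A
  trunc_mem : ∀ m ∈ A, trunc K m ∈ A
  full_mem : (fun _ => K) ∈ A

theorem IsTarget.exists_lt {K : ℕ} {A : Set (E → ℕ)} (hA : IsTarget K A) {m : E → ℕ} (hm : m ∉ A) :
    ∃ e, m e < K := by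
  by_contra! h
  exact hm (hA.upper (fun e => h e) hA.full_mem)

theorem IsTarget.trunc_mem_iff {K : ℕ} {A : Set (E → ℕ)} (hA : IsTarget K A) {m : E → ℕ} :
    trunc K m ∈ A ↔ m ∈ A :=
  ⟨fun h => hA.upper (fun _ => min_le_left _ _) h, hA.trunc_mem m⟩

theorem IsTarget.addEdge_mem {K : ℕ} {A : Set (E → ℕ)} (hA : IsTarget K A) {m : E → ℕ} (hm : m ∈ A)
    (e : E) : addEdge m e ∈ A := hA.upper (le_addEdge m e) hm

/-- The maximum principle for the generator. -/
theorem maximum_principle {w : E → ℝ} (hw : ∀ e, 0 < w e) {K : ℕ} {A : Set (E → ℕ)}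
    (hA : IsTarget K A) {φ : (E → ℕ) → ℝ} (hφA : ∀ m ∈ A, φ m ≤ 0)
    (hgen : ∀ m ∉ A, 0 ≤ gen w φ m) (hK : ∀ m e, K ≤ m e → φ (addEdge m e) ≤ φ m) (m : E → ℕ) :
    φ m ≤ 0 := by
  -- An arrival below `K` copies lowers the deficit, and any other cannot raise `φ`. At a positive
  -- value off `A` no term of the generator is then positive, and one is negative.
  induction h : deficit K m using Nat.strong_induction_on generalizing m with
  | _ n ih =>
    by_cases hm : m ∈ A
    · exact hφA m hm
    by_contra! hpos
    obtain ⟨e₀, he₀⟩ := hA.exists_lt hm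
    have key : ∀ e, m e < K → φ (addEdge m e) ≤ 0 := fun e he =>
      ih _ (by have := deficit_addEdge he; omega) _ rfl
    have hle : ∀ e, w e * (φ (addEdge m e) - φ m) ≤ 0 := fun e => by
      refine mul_nonpos_of_nonneg_of_nonpos (hw e).le ?_
      rcases lt_or_ge (m e) K with he | he
      · linarith [key e he]
      · linarith [hK m e he]
    have hlt : gen w φ m < 0 := by
      refine Finset.sum_neg' (fun e _ => hle e) ⟨e₀, Finset.mem_univ _, ?_⟩
      exact mul_neg_of_pos_of_neg (hw e₀) (by linarith [key e₀ he₀])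
    linarith [hgen m hm]

/-- `h` vanishes on `A`, solves `gen w h = -c` off `A`, and depends only on the multiplicities cut
down to `K`. -/
structure IsSolution (w : E → ℝ) (K : ℕ) (A : Set (E → ℕ)) (c h : (E → ℕ) → ℝ) : Prop where
  eq_zero : ∀ m ∈ A, h m = 0
  gen_eq : ∀ m ∉ A, gen w h m = -c m
  step : ∀ m e, K ≤ m e → h (addEdge m e) = h m

open Classical in
/-- Solution of the first-step equations by recursion on the deficit. -/
noncomputable def solve (w : E → ℝ) (K : ℕ) (A : Set (E → ℕ)) (c : (E → ℕ) → ℝ) :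
    ℕ → (E → ℕ) → ℝ
  -- Deficit `0` means at least `K` copies of everything, which lies in any target.
  | 0, _ => 0
  | n + 1, m => if m ∈ A then 0 else
      (c m + ∑ e with m e < K, w e * solve w K A c n (addEdge m e)) / ∑ e with m e < K, w e

theorem trunc_addEdge_of_lt {K : ℕ} {m : E → ℕ} {e : E} (h : m e < K) :
    trunc K (addEdge m e) = addEdge (trunc K m) e := by
  funext x
  by_cases hx : x = e
  · subst hx
    rw [addEdge_self]
    simp only [trunc, addEdge_self]
    omega
  · rw [addEdge_of_ne _ hx]
    simp only [trunc, addEdge_of_ne _ hx]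

theorem trunc_addEdge_of_le {K : ℕ} {m : E → ℕ} {e : E} (h : K ≤ m e) :
    trunc K (addEdge m e) = trunc K m := by
  funext x
  by_cases hx : x = e
  · subst hx
    simp only [trunc, addEdge_self]
    omega
  · simp only [trunc, addEdge_of_ne _ hx]

theorem exists_isSolution {w : E → ℝ} (hw : ∀ e, 0 < w e) {K : ℕ} {A : Set (E → ℕ)}
    (hA : IsTarget K A) {c : (E → ℕ) → ℝ} (hc : ∀ m, c (trunc K m) = c m) :
    ∃ h, IsSolution w K A c h := by
  set s : (E → ℕ) → ℝ := fun m => solve w K A c (deficit K m) m with hs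
  have sA : ∀ m ∈ A, s m = 0 := by
    intro m hm
    simp only [hs]
    cases deficit K m with
    | zero => rfl
    | succ n => simp [solve, hm]
  have sgen : ∀ m ∉ A, ∑ e with m e < K, w e * (s (addEdge m e) - s m) = -c m := by
    intro m hm
    obtain ⟨e₀, he₀⟩ := hA.exists_lt hm
    obtain ⟨n, hn⟩ : ∃ n, deficit K m = n + 1 := ⟨_, (deficit_addEdge he₀).symm⟩
    have hpos : 0 < ∑ e with m e < K, w e :=
      Finset.sum_pos (fun e _ => hw e) ⟨e₀, by simpa using he₀⟩
    have h1 : s m = (c m + ∑ e with m e < K, w e * s (addEdge m e)) / ∑ e with m e < K, w e := by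
      have : ∀ e ∈ Finset.univ.filter (fun e => m e < K),
          w e * s (addEdge m e) = w e * solve w K A c n (addEdge m e) := by
        intro e he
        have := deficit_addEdge (Finset.mem_filter.1 he).2
        simp only [hs]
        rw [show deficit K (addEdge m e) = n by omega]
      rw [Finset.sum_congr rfl this]
      simp only [hs, hn, solve, if_neg hm]
    rw [eq_div_iff hpos.ne'] at h1
    simp only [mul_sub, Finset.sum_sub_distrib, ← Finset.sum_mul]
    linarith
  -- After precomposition with `trunc`, arrivals beyond `K` copies change nothing, so only edges
  -- below `K` contribute to the generator.
  refine ⟨fun m => s (trunc K m), fun m hm => sA _ (hA.trunc_mem m hm), fun m hm => ?_,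
    fun m e h => by simp only [trunc_addEdge_of_le h]⟩
  rw [← hc, ← sgen _ (mt hA.trunc_mem_iff.1 hm), gen, Finset.sum_filter]
  refine Finset.sum_congr rfl fun e _ => ?_
  by_cases h : m e < K
  · have : trunc K m e < K := by simp [trunc, h]
    rw [if_pos this, trunc_addEdge_of_lt h]
  · have : ¬ trunc K m e < K := by simp [trunc, h]
    rw [if_neg this, trunc_addEdge_of_le (not_lt.1 h), sub_self, mul_zero]

/-- Makes `2 * h` an admissible right-hand side in `exists_isSolution`, as the second-moment
equation requires. -/
theorem IsSolution.trunc {w : E → ℝ} {K : ℕ} {A : Set (E → ℕ)} {c h : (E → ℕ) → ℝ}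
    (hh : IsSolution w K A c h) (m : E → ℕ) : h (trunc K m) = h m := by
  induction hn : ∑ e, (m e - K) generalizing m with
  | zero =>
    congr 1
    funext e
    have := (Finset.sum_eq_zero_iff.1 hn) e (Finset.mem_univ e)
    simp only [MultigraphProcess.trunc]
    omega
  | succ n ih =>
    obtain ⟨e, -, he⟩ : ∃ e ∈ Finset.univ, m e - K ≠ 0 := by
      apply Finset.exists_ne_zero_of_sum_ne_zero
      omega
    obtain ⟨m', rfl⟩ := exists_eq_addEdge (m := m) (e := e) (by omega)
    rw [addEdge_self] at he
    rw [hh.step _ _ (by omega), trunc_addEdge_of_le (by omega)]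
    apply ih
    rw [← Finset.add_sum_erase _ _ (Finset.mem_univ e)] at hn ⊢
    rw [addEdge_self] at hn
    have : ∑ x ∈ Finset.univ.erase e, (addEdge m' e x - K) = ∑ x ∈ Finset.univ.erase e, (m' x - K) :=
      Finset.sum_congr rfl fun x hx => by rw [addEdge_of_ne _ (Finset.ne_of_mem_erase hx)]
    omega

variable {w : E → ℝ} {K : ℕ} {A : Set (E → ℕ)} {h : (E → ℕ) → ℝ}

theorem gen_sub (φ ψ : (E → ℕ) → ℝ) (m : E → ℕ) :
    gen w (fun m => φ m - ψ m) m = gen w φ m - gen w ψ m := by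
  simp only [gen, ← Finset.sum_sub_distrib]
  exact Finset.sum_congr rfl fun e _ => by ring

theorem gen_const_mul (a : ℝ) (φ : (E → ℕ) → ℝ) (m : E → ℕ) :
    gen w (fun m => a * φ m) m = a * gen w φ m := by
  simp only [gen, Finset.mul_sum]
  exact Finset.sum_congr rfl fun e _ => by ring

theorem gen_const (a : ℝ) (m : E → ℕ) : gen w (fun _ => a) m = 0 := by
  simp [gen]

theorem IsSolution.nonneg (hw : ∀ e, 0 < w e) (hA : IsTarget K A) {c : (E → ℕ) → ℝ}
    (hc : ∀ m, 0 ≤ c m) (hh : IsSolution w K A c h) (m : E → ℕ) : 0 ≤ h m := by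
  have := maximum_principle hw hA (φ := fun m => (-1) * h m)
    (fun m hm => by simp [hh.eq_zero m hm])
    (fun m hm => by rw [gen_const_mul, hh.gen_eq m hm]; linarith [hc m])
    (fun m e he => by simp only [hh.step m e he]; exact le_rfl) m
  linarith

/-- Comparison of a subsolution with the solution of `gen w h = -1`. -/
theorem IsSolution.le_of_subsolution (hw : ∀ e, 0 < w e) (hA : IsTarget K A)
    (hh : IsSolution w K A 1 h) {φ : (E → ℕ) → ℝ} (hφA : ∀ m ∈ A, φ m ≤ 0)
    (hgen : ∀ m ∉ A, -1 ≤ gen w φ m) (hK : ∀ m e, K ≤ m e → φ (addEdge m e) ≤ φ m) (m : E → ℕ) :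
    φ m ≤ h m := by
  have := maximum_principle hw hA (φ := fun m => φ m - h m)
    (fun m hm => by simp only [hh.eq_zero m hm]; linarith [hφA m hm])
    (fun m hm => by rw [gen_sub, hh.gen_eq m hm]; simp only [Pi.one_apply]; linarith [hgen m hm])
    (fun m e he => by simp only [hh.step m e he]; linarith [hK m e he]) m
  linarith

theorem gen_comp_addEdge (φ : (E → ℕ) → ℝ) (e₀ : E) (m : E → ℕ) :
    gen w (fun m => φ (addEdge m e₀)) m = gen w φ (addEdge m e₀) := by
  simp only [gen]
  exact Finset.sum_congr rfl fun e _ => by rw [addEdge_comm]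

/-- A head start cannot hurt: since `A` is increasing, the translate of `h` is a subsolution of the
same equation. -/
theorem IsSolution.addEdge_le (hw : ∀ e, 0 < w e) (hA : IsTarget K A) (hh : IsSolution w K A 1 h)
    (m : E → ℕ) (e : E) : h (addEdge m e) ≤ h m := by
  refine hh.le_of_subsolution hw hA (φ := fun m => h (addEdge m e))
    (fun m hm => (hh.eq_zero _ (hA.addEdge_mem hm e)).le) (fun m hm => ?_) (fun m e' he' => ?_) m
  · rw [gen_comp_addEdge]
    by_cases hm' : addEdge m e ∈ A
    · simp only [gen]
      refine le_trans (by norm_num) (Finset.sum_nonneg fun e' _ => ?_)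
      rw [hh.eq_zero _ hm', hh.eq_zero _ (hA.addEdge_mem hm' _)]
      simp
    · rw [hh.gen_eq _ hm']
      simp
  · rw [addEdge_comm]
    exact (hh.step _ _ (he'.trans (le_addEdge m e e'))).le

/-- While both states are off `A` the two source terms cancel and the difference is harmonic, so it
is controlled by its values where the extra copy first reaches `A`. -/
theorem IsSolution.sub_addEdge_le (hw : ∀ e, 0 < w e) (hA : IsTarget K A)
    (hh : IsSolution w K A 1 h) {κ : ℝ} (hκ : 0 ≤ κ)
    (hb : ∀ m ∉ A, ∀ e, addEdge m e ∈ A → h m ≤ κ) (m : E → ℕ) (e : E) :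
    h m - h (addEdge m e) ≤ κ := by
  -- States with `K ≤ m e` are added because the difference is zero there; this also makes the set
  -- depend only on truncated multiplicities.
  have hB : IsTarget K {m | addEdge m e ∈ A ∨ K ≤ m e} := by
    refine ⟨?_, ?_, Or.inr le_rfl⟩
    · rintro m m' hmm' (hm | hm)
      · exact Or.inl (hA.upper (by simpa [addEdge] using hmm') hm)
      · exact Or.inr (hm.trans (hmm' e))
    · rintro m hm
      by_cases h1 : m e < K
      · refine Or.inl ?_
        rw [← trunc_addEdge_of_lt h1, hA.trunc_mem_iff]
        exact hm.resolve_right (not_le.2 h1)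
      · exact Or.inr (by simp [MultigraphProcess.trunc, not_lt.1 h1])
  have := maximum_principle hw hB (φ := fun m => h m - h (addEdge m e) - κ) ?_ ?_ ?_ m
  · linarith
  · rintro m (hm | hm)
    · rw [hh.eq_zero _ hm]
      by_cases hm' : m ∈ A
      · rw [hh.eq_zero _ hm']; linarith
      · linarith [hb m hm' e hm]
    · rw [hh.step _ _ hm]; linarith
  · intro m hm
    simp only [Set.mem_ofPred_eq, not_or] at hm
    have hm' : m ∉ A := fun h' => hm.1 (hA.addEdge_mem h' e)
    rw [gen_sub (fun m => h m - h (addEdge m e)), gen_sub, gen_const, gen_comp_addEdge,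
      hh.gen_eq _ hm', hh.gen_eq _ hm.1]
    simp
  · intro m e' he'
    rw [addEdge_comm, hh.step _ _ he', hh.step _ _ (he'.trans (le_addEdge m e e'))]

/-- If one arrival lowers the mean hitting time by at most `κ`, then the variance of the hitting
time is at most `κ` times its mean. -/
theorem IsSolution.variance_le (hw : ∀ e, 0 < w e) (hA : IsTarget K A)
    (hh : IsSolution w K A 1 h) {g : (E → ℕ) → ℝ} (hg : IsSolution w K A (fun m => 2 * h m) g)
    {κ : ℝ} (hb : ∀ m e, h m - h (addEdge m e) ≤ κ) (m : E → ℕ) :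
    g m - h m ^ 2 ≤ κ * h m := by
  have := maximum_principle hw hA (φ := fun m => g m - h m ^ 2 - κ * h m) ?_ ?_ ?_ m
  · linarith
  · intro m hm
    simp [hg.eq_zero m hm, hh.eq_zero m hm]
  · intro m hm
    rw [gen_sub (fun m => g m - h m ^ 2), gen_sub, gen_const_mul, hg.gen_eq m hm, hh.gen_eq m hm]
    -- For a drop `d`, the change of `h ^ 2` is `-2 * h m * d + d ^ 2`, and `0 ≤ d ≤ κ` gives `d ^ 2
    -- ≤ κ * d`.
    have hsq : gen w (fun m => h m ^ 2) m ≤ 2 * h m * gen w h m + κ * -gen w h m := by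
      simp only [gen, Finset.mul_sum, ← Finset.sum_neg_distrib, ← Finset.sum_add_distrib]
      refine Finset.sum_le_sum fun e _ => ?_
      have h1 := hb m e
      have h2 := hh.addEdge_le hw hA m e
      have : w e * ((h m - h (addEdge m e)) * (h m - h (addEdge m e))) ≤
          w e * (κ * (h m - h (addEdge m e))) :=
        mul_le_mul_of_nonneg_left (mul_le_mul_of_nonneg_right h1 (by linarith)) (hw e).le
      nlinarith
    rw [hh.gen_eq m hm] at hsq
    simp only [Pi.one_apply] at hsq ⊢
    linarith
  · intro m e he
    simp only [hh.step m e he, hg.step m e he]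
    exact le_rfl

theorem IsSolution.pos_of_notMem (hw : ∀ e, 0 < w e) (hA : IsTarget K A)
    (hh : IsSolution w K A 1 h) {m : E → ℕ} (hm : m ∉ A) : 0 < h m := by
  have h0 := hh.nonneg hw hA (fun _ => zero_le_one)
  refine lt_of_le_of_ne (h0 m) fun h1 => ?_
  have h2 := hh.gen_eq m hm
  have : 0 ≤ gen w h m := Finset.sum_nonneg fun e _ =>
    mul_nonneg (hw e).le (by rw [← h1, sub_zero]; exact h0 _)
  simp only [Pi.one_apply] at h2
  linarith

end Generator

/-! ### Packings of disjoint members of a family -/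

section Packing

variable {E : Type*} [Fintype E] [DecidableEq E]

theorem state_induction {P : (E → ℕ) → Prop} (zero : P 0) (add : ∀ m e, P m → P (addEdge m e))
    (m : E → ℕ) : P m := by
  induction hn : ∑ e, m e generalizing m with
  | zero =>
    have : m = 0 := funext fun e => (Finset.sum_eq_zero_iff.1 hn) e (Finset.mem_univ e)
    rwa [this]
  | succ n ih =>
    obtain ⟨e, -, he⟩ : ∃ e ∈ Finset.univ, m e ≠ 0 :=
      Finset.exists_ne_zero_of_sum_ne_zero (by omega)
    obtain ⟨m', rfl⟩ := exists_eq_addEdge he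
    refine add _ _ (ih _ ?_)
    simp only [addEdge, Pi.add_apply, Finset.sum_add_distrib] at hn
    simpa using hn

theorem antitone_of_addEdge_le {φ : (E → ℕ) → ℝ} (h : ∀ m e, φ (addEdge m e) ≤ φ m) :
    Antitone φ := by
  have : ∀ n m : E → ℕ, φ (m + n) ≤ φ m := fun n => by
    induction n using state_induction with
    | zero => simp
    | add n e ih =>
      intro m
      rw [← addEdge_add]
      exact (h _ _).trans (ih m)
  intro m m' hm
  obtain ⟨n, rfl⟩ := exists_add_of_le hm
  exact this n m

/-- With `m e` copies of each `e`, one can form `k` disjoint members of the family `𝒯`. -/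
def Packs (𝒯 : Set (Finset E)) (k : ℕ) : Set (E → ℕ) :=
  {m | ∃ S : Fin k → Finset E, (∀ i, S i ∈ 𝒯) ∧ ∀ e, (Finset.univ.filter fun i => e ∈ S i).card ≤ m e}

variable {𝒯 : Set (Finset E)} {k : ℕ}

/-- Each of the `k` members uses an edge at most once, so copies beyond `k` are superfluous. -/
theorem isTarget_packs (h𝒯 : 𝒯.Nonempty) {K : ℕ} (hkK : k ≤ K) : IsTarget K (Packs 𝒯 k) := by
  have hk : ∀ (S : Fin k → Finset E) e, (Finset.univ.filter fun i => e ∈ S i).card ≤ K := fun S e =>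
    (Finset.card_filter_le _ _).trans (by simpa using hkK)
  refine ⟨?_, ?_, ?_⟩
  · rintro m m' hm ⟨S, hS, hc⟩
    exact ⟨S, hS, fun e => (hc e).trans (hm e)⟩
  · rintro m ⟨S, hS, hc⟩
    exact ⟨S, hS, fun e => le_min (hc e) (hk S e)⟩
  · obtain ⟨T, hT⟩ := h𝒯
    exact ⟨fun _ => T, fun _ => hT, hk _⟩

theorem zero_notMem_packs (h𝒯 : ∀ S ∈ 𝒯, S.Nonempty) (hk : 1 ≤ k) : 0 ∉ Packs 𝒯 k := by
  rintro ⟨S, hS, hc⟩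
  obtain ⟨e, he⟩ := h𝒯 _ (hS ⟨0, hk⟩)
  have := hc e
  simp only [Pi.zero_apply, nonpos_iff_eq_zero, Finset.card_eq_zero] at this
  exact Finset.notMem_empty (⟨0, hk⟩ : Fin k) (this ▸ by simpa using he)

/-! ### Exchange along cuts -/

section Exchange

variable {𝒞 : Set (Finset E)}

/-- Some member of the packing contains `e`, or the extra copy would not be needed. Exchanging `e`
for `e'` in that one member trades the extra copy of `e` for one of `e'`. -/
theorem packs_exchange (hex : ∀ S ∈ 𝒯, ∀ e ∈ S, ∃ C ∈ 𝒞, ∀ e' ∈ C, insert e' (S.erase e) ∈ 𝒯)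
    {m : E → ℕ} (hm : m ∉ Packs 𝒯 k) {e : E} (hme : addEdge m e ∈ Packs 𝒯 k) :
    ∃ C ∈ 𝒞, ∀ e' ∈ C, addEdge m e' ∈ Packs 𝒯 k := by
  obtain ⟨S, hS, hc⟩ := hme
  obtain ⟨i, hi⟩ : ∃ i, e ∈ S i := by
    by_contra! hno
    refine hm ⟨S, hS, fun x => ?_⟩
    by_cases hx : x = e
    · subst hx
      simp [hno]
    · rw [← addEdge_of_ne m hx]
      exact hc x
  obtain ⟨C, hC, hCex⟩ := hex _ (hS i) e hi
  refine ⟨C, hC, fun e' he' => ⟨Function.update S i (insert e' ((S i).erase e)), fun j => ?_,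
    fun x => ?_⟩⟩
  · by_cases hj : j = i
    · subst hj
      simpa using hCex e' he'
    · simpa [hj] using hS j
  · have hcx := hc x
    rw [Finset.card_filter, ← Finset.add_sum_erase _ _ (Finset.mem_univ i)] at hcx ⊢
    have : ∑ j ∈ Finset.univ.erase i,
        (if x ∈ Function.update S i (insert e' ((S i).erase e)) j then 1 else 0) =
        ∑ j ∈ Finset.univ.erase i, (if x ∈ S j then 1 else 0) :=
      Finset.sum_congr rfl fun j hj => by rw [Function.update_of_ne (Finset.ne_of_mem_erase hj)]
    rw [this, Function.update_self]
    by_cases hx' : x = e'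
    · subst hx'
      by_cases hxe : x = e
      · subst hxe
        simpa [hi] using hcx
      · rw [addEdge_of_ne _ hxe] at hcx
        rw [addEdge_self]
        have : (if x ∈ insert x ((S i).erase e) then 1 else 0) ≤ 1 := by split_ifs <;> simp
        omega
    · rw [addEdge_of_ne _ hx']
      by_cases hxe : x = e
      · subst hxe
        rw [addEdge_self] at hcx
        simp only [hi, if_true] at hcx
        simp only [Finset.mem_insert, hx', Finset.mem_erase, ne_eq, not_true_eq_false, false_and,
          or_self, if_false]
        omega
      · rw [addEdge_of_ne _ hxe] at hcx
        simpa [hx', hxe] using hcx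

variable {w : E → ℝ} {h : (E → ℕ) → ℝ} {K : ℕ}

/-- Disjoint members meeting `C` need `k` arrivals in `C`, which come at total rate `∑ e ∈ C, w e`.
The subsolution is the number still missing, divided by this rate. -/
theorem le_mul_solution_of_meets (hw : ∀ e, 0 < w e) (h𝒯 : 𝒯.Nonempty)
    (hh : IsSolution w k (Packs 𝒯 k) 1 h) {C : Finset E} (hC : ∀ S ∈ 𝒯, ∃ e ∈ S, e ∈ C) :
    (k : ℝ) ≤ (∑ e ∈ C, w e) * h 0 := by
  obtain ⟨T, hT⟩ := h𝒯
  obtain ⟨e₀, -, he₀⟩ := hC T hT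
  have hW : 0 < ∑ e ∈ C, w e := Finset.sum_pos (fun e _ => hw e) ⟨e₀, he₀⟩
  set W := ∑ e ∈ C, w e with hWdef
  have hsum : ∀ (m : E → ℕ) e, (∑ x ∈ C, (addEdge m e x : ℝ)) =
      ∑ x ∈ C, (m x : ℝ) + if e ∈ C then 1 else 0 := by
    intro m e
    simp [addEdge, Finset.sum_add_distrib, Pi.single_apply]
  have := hh.le_of_subsolution hw (isTarget_packs ⟨T, hT⟩ le_rfl)
    (φ := fun m => W⁻¹ * max ((k : ℝ) - ∑ e ∈ C, (m e : ℝ)) 0) ?_ ?_ ?_ 0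
  · simp only [Pi.zero_apply, Nat.cast_zero, Finset.sum_const_zero, sub_zero] at this
    rw [max_eq_left (Nat.cast_nonneg k), inv_mul_le_iff₀ hW] at this
    exact this
  · rintro m ⟨S, hS, hc⟩
    have : (k : ℝ) ≤ ∑ e ∈ C, (m e : ℝ) := by
      rw [← Nat.cast_sum, Nat.cast_le]
      calc k = ∑ i : Fin k, 1 := by simp
        _ ≤ ∑ i : Fin k, ∑ e ∈ C, if e ∈ S i then 1 else 0 := Finset.sum_le_sum fun i _ => by
            obtain ⟨e, he, heC⟩ := hC _ (hS i)
            rw [← Finset.card_filter]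
            exact Finset.card_pos.2 ⟨e, by simp [he, heC]⟩
        _ = ∑ e ∈ C, ∑ i : Fin k, if e ∈ S i then 1 else 0 := Finset.sum_comm
        _ ≤ ∑ e ∈ C, m e := Finset.sum_le_sum fun e _ => by
            rw [← Finset.card_filter]
            exact hc e
    rw [max_eq_right (by linarith), mul_zero]
  · intro m _
    rw [gen_const_mul]
    have : -W ≤ gen w (fun m => max ((k : ℝ) - ∑ e ∈ C, (m e : ℝ)) 0) m := by
      have h1 : -W = ∑ e, w e * (if e ∈ C then -1 else 0) := by
        simp [hWdef, Finset.sum_ite_mem]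
      rw [h1, gen]
      refine Finset.sum_le_sum fun e _ => mul_le_mul_of_nonneg_left ?_ (hw e).le
      rw [hsum]
      split_ifs
      · have := max_le (a := (k : ℝ) - ∑ e ∈ C, (m e : ℝ)) (b := 0)
          (c := max ((k : ℝ) - (∑ e ∈ C, (m e : ℝ) + 1)) 0 + 1)
          (by linarith [le_max_left ((k : ℝ) - (∑ e ∈ C, (m e : ℝ) + 1)) 0])
          (by linarith [le_max_right ((k : ℝ) - (∑ e ∈ C, (m e : ℝ) + 1)) 0])
        linarith
      · simp
    calc (-1 : ℝ) = W⁻¹ * -W := by field_simp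
      _ ≤ _ := mul_le_mul_of_nonneg_left this (inv_pos.2 hW).le
  · intro m e _
    refine mul_le_mul_of_nonneg_left (max_le_max_right _ ?_) (inv_pos.2 hW).le
    rw [hsum]
    split_ifs <;> linarith

/-- For families with an exchange property along a class of cuts, one arrival lowers the mean
hitting time of a `k`-fold packing by at most `1 / k` of its initial value. -/
theorem sub_addEdge_le_of_exchange (hw : ∀ e, 0 < w e) (h𝒯 : 𝒯.Nonempty) (hk : 1 ≤ k)
    (hh : IsSolution w k (Packs 𝒯 k) 1 h)
    (hex : ∀ S ∈ 𝒯, ∀ e ∈ S, ∃ C ∈ 𝒞, ∀ e' ∈ C, insert e' (S.erase e) ∈ 𝒯)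
    (hC : ∀ C ∈ 𝒞, ∀ S ∈ 𝒯, ∃ e ∈ S, e ∈ C) (m : E → ℕ) (e : E) :
    h m - h (addEdge m e) ≤ h 0 / k := by
  have hA := isTarget_packs (k := k) h𝒯 le_rfl
  have hnn := hh.nonneg hw hA (fun _ => zero_le_one)
  refine hh.sub_addEdge_le hw hA (div_nonneg (hnn 0) (Nat.cast_nonneg k)) (fun m hm e hme => ?_) m e
  obtain ⟨C, hC𝒞, hadd⟩ := packs_exchange hex hm hme
  have h1 : (∑ e ∈ C, w e) * h m ≤ 1 := by
    have h2 := hh.gen_eq m hm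
    have h3 : ∑ e ∈ C, w e * (h m - h (addEdge m e)) ≤ ∑ e, w e * (h m - h (addEdge m e)) :=
      Finset.sum_le_sum_of_subset_of_nonneg (Finset.subset_univ _) fun e _ _ =>
        mul_nonneg (hw e).le (sub_nonneg.2 (hh.addEdge_le hw hA m e))
    have h4 : ∑ e ∈ C, w e * (h m - h (addEdge m e)) = (∑ e ∈ C, w e) * h m := by
      rw [Finset.sum_mul]
      exact Finset.sum_congr rfl fun e he => by rw [hh.eq_zero _ (hadd e he), sub_zero]
    have h5 : ∑ e, w e * (h m - h (addEdge m e)) = -gen w h m := by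
      rw [gen, ← Finset.sum_neg_distrib]
      exact Finset.sum_congr rfl fun e _ => by ring
    rw [← h4]
    refine h3.trans ?_
    rw [h5, h2]
    simp
  have h2 := le_mul_solution_of_meets hw h𝒯 hh (hC C hC𝒞)
  have hk' : (0 : ℝ) < k := by exact_mod_cast hk
  rw [le_div_iff₀ hk']
  calc h m * k ≤ h m * ((∑ e ∈ C, w e) * h 0) := mul_le_mul_of_nonneg_left h2 (hnn m)
    _ = (∑ e ∈ C, w e) * h m * h 0 := by ring
    _ ≤ 1 * h 0 := mul_le_mul_of_nonneg_right h1 (hnn 0)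
    _ = h 0 := one_mul _

end Exchange

/-! ### Independent thinning and comparison with a single member -/

section Thinning

variable {p : ℝ}

/-- The mean of `φ` after a copy of `e` has been kept with probability `p`. -/
def thinStep (p : ℝ) (e : E) (φ : (E → ℕ) → ℝ) (m : E → ℕ) : ℝ :=
  (1 - p) * φ m + p * φ (addEdge m e)

instance : LeftCommutative (thinStep (E := E) p) where
  left_comm e e' φ := by
    funext m
    simp only [thinStep, addEdge_comm m e e']
    ring

/-- The mean of `φ` after each member of `M` has been kept with probability `p`, independently. -/
def thin (p : ℝ) (M : Multiset E) (φ : (E → ℕ) → ℝ) : (E → ℕ) → ℝ :=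
  M.foldr (thinStep p) φ

theorem thin_zero (φ : (E → ℕ) → ℝ) : thin p 0 φ = φ := Multiset.foldr_zero _ _

theorem thin_cons (e : E) (M : Multiset E) (φ : (E → ℕ) → ℝ) :
    thin p (e ::ₘ M) φ = thinStep p e (thin p M φ) := Multiset.foldr_cons _ _ _ _

theorem thin_add (M N : Multiset E) (φ : (E → ℕ) → ℝ) :
    thin p (M + N) φ = thin p M (thin p N φ) := Multiset.foldr_add _ _ _ _

theorem thin_mono (hp : 0 ≤ p) (hp1 : p ≤ 1) (M : Multiset E) {φ ψ : (E → ℕ) → ℝ}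
    (h : ∀ m, φ m ≤ ψ m) (m : E → ℕ) : thin p M φ m ≤ thin p M ψ m := by
  induction M using Multiset.induction_on generalizing m with
  | empty => simpa [thin_zero] using h m
  | cons e M ih =>
    rw [thin_cons, thin_cons]
    exact add_le_add (mul_le_mul_of_nonneg_left (ih _) (by linarith))
      (mul_le_mul_of_nonneg_left (ih _) hp)

theorem thin_const_mul (c : ℝ) (M : Multiset E) (φ : (E → ℕ) → ℝ) (m : E → ℕ) :
    thin p M (fun m => c * φ m) m = c * thin p M φ m := by
  induction M using Multiset.induction_on generalizing m with
  | empty => simp [thin_zero]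
  | cons e M ih =>
    simp only [thin_cons, thinStep, ih]
    ring

theorem antitone_thin (hp : 0 ≤ p) (hp1 : p ≤ 1) (M : Multiset E) {φ : (E → ℕ) → ℝ}
    (h : Antitone φ) : Antitone (thin p M φ) := by
  induction M using Multiset.induction_on with
  | empty => simpa [thin_zero] using h
  | cons e M ih =>
    intro m m' hm
    rw [thin_cons]
    exact add_le_add (mul_le_mul_of_nonneg_left (ih hm) (by linarith))
      (mul_le_mul_of_nonneg_left (ih (by simpa [addEdge] using hm)) hp)

/-- The copies are all kept with probability `p ^ card M`. -/
theorem thin_le (hp : 0 ≤ p) (hp1 : p ≤ 1) (M : Multiset E) {φ : (E → ℕ) → ℝ} (h : Antitone φ)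
    (m : E → ℕ) :
    thin p M φ m ≤ (1 - p ^ M.card) * φ m + p ^ M.card * φ (m + fun x => M.count x) := by
  induction M using Multiset.induction_on generalizing m with
  | empty =>
    have : (fun _ => 0 : E → ℕ) = 0 := rfl
    simp [thin_zero, this]
  | cons e M ih =>
    have hq0 : 0 ≤ p ^ M.card := pow_nonneg hp _
    have hq1 : p ^ M.card ≤ 1 := pow_le_one₀ hp hp1
    have h1 := h (le_addEdge m e)
    have h2 : φ (m + fun x => M.count x) ≤ φ m := h (by simp)
    have h3 : (addEdge m e + fun x => M.count x) = m + fun x => (e ::ₘ M).count x := by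
      funext x
      by_cases hx : x = e
      · subst hx
        simp [addEdge]
        ring
      · simp [addEdge, hx]
    have e1 := ih m
    have e2 := ih (addEdge m e)
    rw [h3] at e2
    rw [thin_cons, thinStep, Multiset.card_cons, pow_succ]
    have e3 : thin p M φ m ≤ φ m := by nlinarith
    have e4 : thin p M φ (addEdge m e) ≤
        (1 - p ^ M.card) * φ m + p ^ M.card * φ (m + fun x => (e ::ₘ M).count x) :=
      e2.trans (add_le_add_left (mul_le_mul_of_nonneg_left h1 (by linarith)) _)
    calc (1 - p) * thin p M φ m + p * thin p M φ (addEdge m e) ≤ (1 - p) * φ m + p *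
          ((1 - p ^ M.card) * φ m + p ^ M.card * φ (m + fun x => (e ::ₘ M).count x)) :=
          add_le_add (mul_le_mul_of_nonneg_left e3 (by linarith)) (mul_le_mul_of_nonneg_left e4 hp)
      _ = _ := by ring

theorem thin_le_self (hp : 0 ≤ p) (hp1 : p ≤ 1) (M : Multiset E) {φ : (E → ℕ) → ℝ}
    (h : Antitone φ) (m : E → ℕ) : thin p M φ m ≤ φ m := by
  have h2 : φ (m + fun x => M.count x) ≤ φ m := h (by simp)
  have hq0 : 0 ≤ p ^ M.card := pow_nonneg hp _
  nlinarith [thin_le hp hp1 M h m]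

theorem thin_le_thin_of_le (hp : 0 ≤ p) (hp1 : p ≤ 1) {M M' : Multiset E} (hM : M ≤ M')
    {φ : (E → ℕ) → ℝ} (h : Antitone φ) (m : E → ℕ) : thin p M' φ m ≤ thin p M φ m := by
  obtain ⟨N, rfl⟩ := exists_add_of_le hM
  rw [add_comm, thin_add]
  exact thin_le_self hp hp1 N (antitone_thin hp hp1 M h) m

/-- Thinning averages translates of `φ`, and the generator commutes with translation. -/
theorem le_gen_thin {w : E → ℝ} (hp : 0 ≤ p) (hp1 : p ≤ 1) (M : Multiset E) {φ : (E → ℕ) → ℝ}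
    {c : ℝ} (h : ∀ m, c ≤ gen w φ m) (m : E → ℕ) : c ≤ gen w (thin p M φ) m := by
  induction M using Multiset.induction_on generalizing m with
  | empty => simpa [thin_zero] using h m
  | cons e M ih =>
    have : gen w (thin p (e ::ₘ M) φ) m =
        (1 - p) * gen w (thin p M φ) m + p * gen w (thin p M φ) (addEdge m e) := by
      simp only [gen, thin_cons, thinStep, Finset.mul_sum, ← Finset.sum_add_distrib]
      refine Finset.sum_congr rfl fun e' _ => ?_
      rw [addEdge_comm m e' e]
      ring
    rw [this]
    nlinarith [ih m, ih (addEdge m e)]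

/-- The multiset with `m e` copies of `e`. -/
def copies (m : E → ℕ) : Multiset E := ∑ e, m e • {e}

theorem count_copies (m : E → ℕ) (e : E) : (copies m).count e = m e := by
  simp [copies, Multiset.count_sum', Multiset.count_singleton]

theorem copies_addEdge (m : E → ℕ) (e : E) : copies (addEdge m e) = e ::ₘ copies m := by
  ext x
  by_cases hx : x = e
  · subst hx
    simp [count_copies, addEdge]
  · simp [count_copies, addEdge, hx]

/-- The thinned chain moves only when an arrival is kept, hence the slowdown by `p`. -/
theorem gen_thin_copies {w : E → ℝ} (φ : (E → ℕ) → ℝ) (m : E → ℕ) :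
    gen w (fun m => thin p (copies m) φ 0) m = p * gen w (thin p (copies m) φ) 0 := by
  simp only [gen, copies_addEdge, thin_cons, thinStep, Finset.mul_sum]
  exact Finset.sum_congr rfl fun e _ => by ring

/-- If `k` disjoint sets of size `r` are available and each copy is kept with probability `p`, then
the probability that no set is kept entirely is at most `(1 - p ^ r) ^ k`. -/
theorem thin_le_of_mem_packs (hp : 0 ≤ p) (hp1 : p ≤ 1) {r : ℕ} (h𝒯 : ∀ S ∈ 𝒯, S.card = r)
    {φ : (E → ℕ) → ℝ} (hφ : Antitone φ) (hφ0 : ∀ m ∈ Packs 𝒯 1, φ m = 0) {m : E → ℕ}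
    (hm : m ∈ Packs 𝒯 k) (n : E → ℕ) : thin p (copies m) φ n ≤ (1 - p ^ r) ^ k * φ n := by
  obtain ⟨S, hS, hc⟩ := hm
  have hr : 0 ≤ 1 - p ^ r := sub_nonneg.2 (pow_le_one₀ hp hp1)
  -- By disjointness the members form a submultiset of the copies; thinning the remaining copies
  -- only lowers the mean of an antitone `φ`.
  have hle : ∑ i, (S i).val ≤ copies m := by
    rw [Multiset.le_iff_count]
    intro e
    rw [Multiset.count_sum', count_copies]
    refine le_trans (le_of_eq ?_) (hc e)
    rw [Finset.card_filter]
    exact Finset.sum_congr rfl fun i _ => by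
      rw [Multiset.count_eq_of_nodup (S i).nodup]
      rfl
  have hone : ∀ i n, thin p (S i).val φ n ≤ (1 - p ^ r) * φ n := by
    intro i n
    have h1 := thin_le hp hp1 (S i).val hφ n
    have h2 : (n + fun x => (S i).val.count x) ∈ Packs 𝒯 1 := by
      refine ⟨fun _ => S i, fun _ => hS i, fun e => ?_⟩
      by_cases he : e ∈ S i
      · have : (S i).val.count e = 1 := Multiset.count_eq_one_of_mem (S i).nodup he
        simp [he, this]
      · simp [he]
    rw [hφ0 _ h2, Finset.card_val, h𝒯 _ (hS i)] at h1
    linarith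
  have hall : ∀ (s : Finset (Fin k)) n,
      thin p (∑ i ∈ s, (S i).val) φ n ≤ (1 - p ^ r) ^ s.card * φ n := by
    intro s
    induction s using Finset.induction_on with
    | empty => simp [thin_zero]
    | insert i s hi ih =>
      intro n
      rw [Finset.sum_insert hi, thin_add, Finset.card_insert_of_notMem hi, pow_succ, mul_assoc]
      refine (thin_mono hp hp1 _ ih n).trans ?_
      rw [thin_const_mul]
      exact mul_le_mul_of_nonneg_left (hone i n) (pow_nonneg hr _)
  refine (thin_le_thin_of_le hp hp1 hle hφ n).trans ?_
  simpa using hall Finset.univ n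

variable {w : E → ℝ} {h h₁ : (E → ℕ) → ℝ} {K : ℕ}

/-- The mean remaining time of the thinned chain starts at `h₁ 0 / p`, falls at rate at most 1, and
is at most `(1 - p ^ r) ^ k * h₁ 0 / p` once `k` members are packed. Subtracting this last value
yields a subsolution for the `k`-fold problem. -/
theorem mul_solution_one_le (hw : ∀ e, 0 < w e) (h𝒯 : 𝒯.Nonempty) {r : ℕ}
    (hr : ∀ S ∈ 𝒯, S.card = r) (hK : 1 ≤ K) (hkK : k ≤ K)
    (hh₁ : IsSolution w K (Packs 𝒯 1) 1 h₁) (hh : IsSolution w K (Packs 𝒯 k) 1 h)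
    (hp : 0 < p) (hp1 : p ≤ 1) : (1 - (1 - p ^ r) ^ k) * h₁ 0 ≤ p * h 0 := by
  have hA₁ := isTarget_packs (k := 1) h𝒯 hK
  have hA := isTarget_packs (k := k) h𝒯 hkK
  have hanti : Antitone h₁ := antitone_of_addEdge_le (hh₁.addEdge_le hw hA₁)
  have hgen₁ : ∀ m, -1 ≤ gen w h₁ m := by
    intro m
    by_cases hm : m ∈ Packs 𝒯 1
    · refine le_trans (by norm_num) (Finset.sum_nonneg fun e _ => ?_)
      rw [hh₁.eq_zero _ hm, hh₁.eq_zero _ (hA₁.addEdge_mem hm e), sub_self, mul_zero]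
    · rw [hh₁.gen_eq m hm]
      exact le_rfl
  have := hh.le_of_subsolution hw hA
    (φ := fun m => p⁻¹ * (thin p (copies m) h₁ 0 - (1 - p ^ r) ^ k * h₁ 0)) ?_ ?_ ?_ 0
  · have hc : copies (0 : E → ℕ) = 0 := by simp [copies]
    rw [hc, thin_zero, inv_mul_le_iff₀ hp] at this
    linarith
  · intro m hm
    have := thin_le_of_mem_packs hp.le hp1 hr hanti hh₁.eq_zero hm 0
    exact mul_nonpos_of_nonneg_of_nonpos (inv_pos.2 hp).le (by linarith)
  · intro m _
    rw [gen_const_mul, gen_sub (fun m => thin p (copies m) h₁ 0), gen_const, gen_thin_copies,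
      sub_zero, inv_mul_cancel_left₀ hp.ne']
    exact le_gen_thin hp.le hp1 _ hgen₁ 0
  · intro m e _
    refine mul_le_mul_of_nonneg_left (sub_le_sub_right ?_ _) (inv_pos.2 hp).le
    rw [copies_addEdge]
    exact thin_le_thin_of_le hp.le hp1 (Multiset.le_cons_self _ _) hanti 0

/-- Discard one member: one containing `e` if there is any, otherwise an arbitrary one. -/
theorem mem_packs_of_addEdge_mem {m : E → ℕ} {e : E} (h : addEdge m e ∈ Packs 𝒯 (k + 1)) :
    m ∈ Packs 𝒯 k := by
  obtain ⟨S, hS, hc⟩ := h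
  have key : ∀ i x, (Finset.univ.filter fun j => x ∈ S (Fin.succAbove i j)).card +
      (if x ∈ S i then 1 else 0) ≤ addEdge m e x := by
    intro i x
    refine le_trans (le_of_eq ?_) (hc x)
    rw [Finset.card_filter, Finset.card_filter, Fin.sum_univ_succAbove _ i, add_comm]
  by_cases hi : ∃ i, e ∈ S i
  · obtain ⟨i, hi⟩ := hi
    refine ⟨fun j => S (i.succAbove j), fun j => hS _, fun x => ?_⟩
    have := key i x
    beta_reduce
    by_cases hx : x = e
    · subst hx
      rw [addEdge_self, if_pos hi] at this
      omega
    · rw [addEdge_of_ne _ hx] at this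
      omega
  · push Not at hi
    refine ⟨fun j => S (Fin.succAbove 0 j), fun j => hS _, fun x => ?_⟩
    by_cases hx : x = e
    · subst hx
      simp [hi]
    · have := key 0 x
      beta_reduce
      rw [addEdge_of_ne _ hx] at this
      omega

theorem add_mem_packs {m n : E → ℕ} (hm : m ∈ Packs 𝒯 k) (hn : n ∈ Packs 𝒯 1) :
    m + n ∈ Packs 𝒯 (k + 1) := by
  obtain ⟨S, hS, hc⟩ := hm
  obtain ⟨T, hT, hd⟩ := hn
  refine ⟨Fin.cons (T 0) S, fun i => ?_, fun x => ?_⟩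
  · refine Fin.cases ?_ (fun j => ?_) i
    · simpa using hT 0
    · simpa using hS j
  · have h1 := hc x
    have h2 := hd x
    rw [Finset.card_filter] at h1 h2 ⊢
    rw [Fin.sum_univ_succ] at h2 ⊢
    simp only [Fin.cons_zero, Fin.cons_succ, Pi.add_apply]
    simp only [Finset.univ_eq_empty, Finset.sum_empty, add_zero] at h2
    omega

/-- One arrival lowers the mean hitting time of a `k`-fold packing by at most the mean hitting
time of a single member of the family. -/
theorem sub_addEdge_le_solution_one (hw : ∀ e, 0 < w e) (h𝒯 : 𝒯.Nonempty) (hk : 1 ≤ k)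
    (hkK : k ≤ K) (hh₁ : IsSolution w K (Packs 𝒯 1) 1 h₁) (hh : IsSolution w K (Packs 𝒯 k) 1 h)
    (m : E → ℕ) (e : E) : h m - h (addEdge m e) ≤ h₁ 0 := by
  have hA₁ := isTarget_packs (k := 1) h𝒯 (hk.trans hkK)
  have hA := isTarget_packs (k := k) h𝒯 hkK
  refine hh.sub_addEdge_le hw hA (hh₁.nonneg hw hA₁ (fun _ => zero_le_one) 0)
    (fun m hm e hme => ?_) m e
  obtain ⟨j, rfl⟩ : ∃ j, k = j + 1 := ⟨k - 1, by omega⟩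
  have hmj := mem_packs_of_addEdge_mem hme
  have := hh₁.le_of_subsolution hw hA₁ (φ := fun n => h (m + n))
    (fun n hn => (hh.eq_zero _ (add_mem_packs hmj hn)).le) (fun n _ => ?_) (fun n e he => ?_) 0
  · simpa using this
  · have h1 : gen w (fun n => h (m + n)) n = gen w h (m + n) := by
      simp only [gen, addEdge_add]
    rw [h1]
    by_cases hmn : m + n ∈ Packs 𝒯 (j + 1)
    · refine le_trans (by norm_num) (Finset.sum_nonneg fun e _ => ?_)
      rw [hh.eq_zero _ hmn, hh.eq_zero _ (hA.addEdge_mem hmn e), sub_self, mul_zero]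
    · rw [hh.gen_eq _ hmn]
      exact le_rfl
  · simp only [← addEdge_add]
    exact (hh.step _ _ (he.trans (by simp))).le

end Thinning

end Packing

/-! ### Truncated Poisson weights and the forward equation -/

section Analytic

open Filter Topology

/-- The probability of the value `a` under the Poisson distribution of mean `s`. -/
noncomputable def poissonWeight (a : ℕ) (s : ℝ) : ℝ := Real.exp (-s) * s ^ a / a.factorial

theorem poissonWeight_nonneg (a : ℕ) {s : ℝ} (hs : 0 ≤ s) : 0 ≤ poissonWeight a s := by
  unfold poissonWeight
  positivity

theorem sum_poissonWeight_le_one (K : ℕ) {s : ℝ} (hs : 0 ≤ s) :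
    ∑ a ∈ Finset.range K, poissonWeight a s ≤ 1 := by
  have h := mul_le_mul_of_nonneg_left (Real.sum_le_exp_of_nonneg hs K) (Real.exp_pos (-s)).le
  rw [← Real.exp_add, neg_add_cancel, Real.exp_zero, Finset.mul_sum] at h
  simpa only [poissonWeight, mul_div_assoc] using h

theorem hasDerivAt_poissonWeight (a : ℕ) (s : ℝ) :
    HasDerivAt (poissonWeight a)
      ((if a = 0 then 0 else poissonWeight (a - 1) s) - poissonWeight a s) s := by
  have h1 : HasDerivAt (fun s : ℝ => Real.exp (-s)) (-Real.exp (-s)) s := by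
    simpa using (hasDerivAt_neg s).exp
  have h2 := (h1.mul (hasDerivAt_pow a s)).div_const (a.factorial : ℝ)
  refine h2.congr_deriv ?_
  cases a with
  | zero => simp [poissonWeight]
  | succ n =>
    simp only [poissonWeight, Nat.add_one_ne_zero, if_false, Nat.add_sub_cancel, Nat.factorial_succ]
    push_cast
    have : (n.factorial : ℝ) ≠ 0 := by positivity
    field_simp
    ring

/-- The probability that a Poisson variable of mean `s`, cut down to at most `K`, is `a`. -/
noncomputable def cutWeight (K a : ℕ) (s : ℝ) : ℝ :=
  if a < K then poissonWeight a s else 1 - ∑ b ∈ Finset.range K, poissonWeight b s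

theorem cutWeight_nonneg (K a : ℕ) {s : ℝ} (hs : 0 ≤ s) : 0 ≤ cutWeight K a s := by
  unfold cutWeight
  split_ifs
  · exact poissonWeight_nonneg a hs
  · exact sub_nonneg.2 (sum_poissonWeight_le_one K hs)

theorem cutWeight_le_one (K a : ℕ) {s : ℝ} (hs : 0 ≤ s) : cutWeight K a s ≤ 1 := by
  unfold cutWeight
  split_ifs
  · refine le_trans ?_ (sum_poissonWeight_le_one (a + 1) hs)
    exact Finset.single_le_sum (f := fun b => poissonWeight b s)
      (fun b _ => poissonWeight_nonneg b hs) (Finset.mem_range.2 a.lt_succ_self)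
  · exact sub_le_self _ (Finset.sum_nonneg fun b _ => poissonWeight_nonneg b hs)

/-- The truncated count is absorbed at `K`: no outflow there, and the derivatives of the lower
weights telescope to the inflow. -/
theorem hasDerivAt_cutWeight {K a : ℕ} (ha : a ≤ K) (hK : 1 ≤ K) (s : ℝ) :
    HasDerivAt (cutWeight K a) ((if a = 0 then 0 else cutWeight K (a - 1) s) -
      if a < K then cutWeight K a s else 0) s := by
  rcases ha.lt_or_eq with h | rfl
  · have h1 : cutWeight K a = poissonWeight a := funext fun s => if_pos h
    have h2 : cutWeight K (a - 1) s = poissonWeight (a - 1) s := if_pos (by omega)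
    rw [if_pos h, h2, h1]
    exact hasDerivAt_poissonWeight a s
  · have h1 : cutWeight a a = fun s => 1 - ∑ b ∈ Finset.range a, poissonWeight b s :=
      funext fun s => if_neg (lt_irrefl _)
    have h2 : cutWeight a (a - 1) s = poissonWeight (a - 1) s := if_pos (by omega)
    rw [if_neg (lt_irrefl _), h2, h1, if_neg (by omega), sub_zero]
    refine ((HasDerivAt.fun_sum fun b _ => hasDerivAt_poissonWeight b s).const_sub 1).congr_deriv ?_
    obtain ⟨n, rfl⟩ : ∃ n, a = n + 1 := ⟨a - 1, by omega⟩
    clear ha h1 h2 hK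
    rw [Nat.add_sub_cancel]
    induction n with
    | zero => simp
    | succ n ih =>
      rw [Finset.sum_range_succ, neg_add, ih]
      simp

theorem cutWeight_zero {K : ℕ} (hK : 1 ≤ K) (a : ℕ) :
    cutWeight K a 0 = if a = 0 then 1 else 0 := by
  have h0 : ∀ b, poissonWeight b 0 = if b = 0 then 1 else 0 := by
    intro b
    cases b <;> simp [poissonWeight]
  unfold cutWeight
  split_ifs with h1 h2 h2
  · simp [h0, h2]
  · simp [h0, h2]
  · omega
  · simp only [h0, Finset.sum_ite_eq', Finset.mem_range]
    rw [if_pos (by omega), sub_self]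

/-- The factor `t` serves the boundary term in the second-moment integral. -/
theorem tendsto_mul_cutWeight {K a : ℕ} (ha : a < K) {r : ℝ} (hr : 0 < r) :
    Tendsto (fun t => t * cutWeight K a (r * t)) atTop (𝓝 0) := by
  have h1 : Tendsto (fun t : ℝ => r * t) atTop atTop := tendsto_id.const_mul_atTop hr
  have h2 := ((Real.tendsto_pow_mul_exp_neg_atTop_nhds_zero (a + 1)).comp h1).const_mul
    (r⁻¹ * (a.factorial : ℝ)⁻¹)
  rw [mul_zero] at h2
  refine h2.congr fun t => ?_
  simp only [Function.comp_apply, cutWeight, if_pos ha, poissonWeight, pow_succ, div_eq_mul_inv]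
  field_simp

variable {E : Type*} [Fintype E] [DecidableEq E]

/-- The states with all multiplicities at most `K`. -/
def box (E : Type*) [Fintype E] [DecidableEq E] (K : ℕ) : Finset (E → ℕ) :=
  Fintype.piFinset fun _ => Finset.range (K + 1)

theorem mem_box {K : ℕ} {m : E → ℕ} : m ∈ box E K ↔ ∀ e, m e ≤ K := by
  simp [box, Fintype.mem_piFinset]

/-- The mean of `φ` at time `t`, with all multiplicities cut down to at most `K`. -/
noncomputable def boxMean (w : E → ℝ) (K : ℕ) (φ : (E → ℕ) → ℝ) (t : ℝ) : ℝ :=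
  ∑ m ∈ box E K, φ m * ∏ e, cutWeight K (m e) (w e * t)

/-- Shifting one coordinate in a sum over the box. -/
theorem sum_box_shift {K : ℕ} (e : E) (φ : (E → ℕ) → ℝ) (q : E → ℕ → ℝ) :
    ∑ m ∈ box E K, φ m *
        ((∏ x ∈ Finset.univ.erase e, q x (m x)) * if m e = 0 then 0 else q e (m e - 1)) =
      ∑ m ∈ box E K, if m e < K then φ (addEdge m e) * ∏ x, q x (m x) else 0 := by
  have h1 : ∀ m : E → ℕ, φ m *
      ((∏ x ∈ Finset.univ.erase e, q x (m x)) * if m e = 0 then 0 else q e (m e - 1)) =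
      if m e ≠ 0 then φ m * ((∏ x ∈ Finset.univ.erase e, q x (m x)) * q e (m e - 1)) else 0 := by
    intro m
    by_cases h : m e = 0 <;> simp [h]
  simp only [h1]
  rw [← Finset.sum_filter, ← Finset.sum_filter]
  symm
  refine Finset.sum_nbij (fun m => addEdge m e) ?_ ?_ ?_ ?_
  · intro m hm
    simp only [Finset.mem_filter, mem_box] at hm ⊢
    refine ⟨fun x => ?_, by simp [addEdge_self]⟩
    by_cases hx : x = e
    · subst hx
      rw [addEdge_self]
      exact hm.2
    · rw [addEdge_of_ne _ hx]
      exact hm.1 x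
  · intro m _ m' _ h
    exact add_right_cancel h
  · intro m hm
    simp only [Finset.coe_filter, mem_box, Set.mem_ofPred_eq] at hm
    obtain ⟨m', rfl⟩ := exists_eq_addEdge hm.2
    refine ⟨m', ?_, rfl⟩
    simp only [Finset.coe_filter, mem_box, Set.mem_ofPred_eq]
    have := hm.1 e
    rw [addEdge_self] at this
    exact ⟨fun x => (le_addEdge m' e x).trans (hm.1 x), this⟩
  · intro m _
    rw [addEdge_self, Nat.add_sub_cancel, ← Finset.prod_erase_mul _ _ (Finset.mem_univ e)]
    congr 2
    exact Finset.prod_congr rfl fun x hx => by rw [addEdge_of_ne _ (Finset.ne_of_mem_erase hx)]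

/-- The forward equation. -/
theorem hasDerivAt_boxMean {w : E → ℝ} {K : ℕ} (hK : 1 ≤ K) {φ : (E → ℕ) → ℝ}
    (hφ : ∀ m e, K ≤ m e → φ (addEdge m e) = φ m) (t : ℝ) :
    HasDerivAt (boxMean w K φ) (boxMean w K (gen w φ) t) t := by
  have h1 : ∀ m ∈ box E K, ∀ e, HasDerivAt (fun t => cutWeight K (m e) (w e * t))
      (((if m e = 0 then 0 else cutWeight K (m e - 1) (w e * t)) -
      if m e < K then cutWeight K (m e) (w e * t) else 0) * w e) t := by
    intro m hm e
    have := (hasDerivAt_cutWeight (mem_box.1 hm e) hK (w e * t)).comp t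
      ((hasDerivAt_id t).const_mul (w e))
    simpa [Function.comp_def] using this
  have h2 := HasDerivAt.fun_sum (u := box E K) fun m hm =>
    (HasDerivAt.fun_finsetProd (u := Finset.univ) fun e _ => h1 m hm e).const_mul (φ m)
  refine h2.congr_deriv ?_
  have h3 : boxMean w K (gen w φ) t = ∑ e, w e * ∑ m ∈ box E K,
      (φ (addEdge m e) - φ m) * ∏ x, cutWeight K (m x) (w x * t) := by
    simp only [boxMean, gen, Finset.sum_mul, Finset.mul_sum]
    rw [Finset.sum_comm]
    exact Finset.sum_congr rfl fun e _ => Finset.sum_congr rfl fun m _ => by ring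
  -- Summation by parts moves the shift from the weights to `φ`. At `m e = K` the vanishing outflow
  -- matches `φ (addEdge m e) = φ m`.
  have h4 : ∀ e, ∑ m ∈ box E K, (φ (addEdge m e) - φ m) * ∏ x, cutWeight K (m x) (w x * t) =
      ∑ m ∈ box E K, φ m * ((∏ x ∈ Finset.univ.erase e, cutWeight K (m x) (w x * t)) *
        ((if m e = 0 then 0 else cutWeight K (m e - 1) (w e * t)) -
        if m e < K then cutWeight K (m e) (w e * t) else 0)) := by
    intro e
    have := sum_box_shift (K := K) e φ fun x a => cutWeight K a (w x * t)
    simp only [mul_sub, Finset.sum_sub_distrib]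
    rw [this, ← Finset.sum_sub_distrib]
    refine Finset.sum_congr rfl fun m _ => ?_
    rw [← Finset.prod_erase_mul _ _ (Finset.mem_univ e)]
    by_cases h : m e < K
    · simp only [if_pos h]
      ring
    · simp only [if_neg h, hφ m e (not_lt.1 h)]
      ring
  rw [h3]
  simp only [h4, Finset.mul_sum, smul_eq_mul]
  rw [Finset.sum_comm]
  exact Finset.sum_congr rfl fun e _ => Finset.sum_congr rfl fun m _ => by ring

theorem boxMean_zero {w : E → ℝ} {K : ℕ} (hK : 1 ≤ K) (φ : (E → ℕ) → ℝ) :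
    boxMean w K φ 0 = φ 0 := by
  simp only [boxMean, mul_zero, cutWeight_zero hK]
  rw [Finset.sum_eq_single 0]
  · simp
  · intro m _ hm
    obtain ⟨e, he⟩ := Function.ne_iff.1 hm
    rw [Finset.prod_eq_zero (Finset.mem_univ e), mul_zero]
    simpa using he
  · intro h
    exact absurd (mem_box.2 fun e => Nat.zero_le K) h

theorem boxMean_nonneg {w : E → ℝ} (hw : ∀ e, 0 < w e) {K : ℕ} {φ : (E → ℕ) → ℝ}
    (hφ : ∀ m, 0 ≤ φ m) {t : ℝ} (ht : 0 ≤ t) : 0 ≤ boxMean w K φ t :=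
  Finset.sum_nonneg fun m _ => mul_nonneg (hφ m) (Finset.prod_nonneg fun e _ =>
    cutWeight_nonneg K _ (mul_nonneg (hw e).le ht))

theorem boxMean_const_mul {w : E → ℝ} {K : ℕ} (c : ℝ) (φ : (E → ℕ) → ℝ) (t : ℝ) :
    boxMean w K (fun m => c * φ m) t = c * boxMean w K φ t := by
  simp only [boxMean, Finset.mul_sum, mul_assoc]

/-- Every state other than the full one has a coordinate below `K`, whose weight decays
exponentially. -/
theorem tendsto_mul_boxMean {w : E → ℝ} (hw : ∀ e, 0 < w e) {K : ℕ} {φ : (E → ℕ) → ℝ}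
    (hφ : φ (fun _ => K) = 0) : Tendsto (fun t => t * boxMean w K φ t) atTop (𝓝 0) := by
  have h : ∀ m ∈ box E K,
      Tendsto (fun t => t * (φ m * ∏ e, cutWeight K (m e) (w e * t))) atTop (𝓝 0) := by
    intro m hm
    by_cases hmK : ∃ e, m e < K
    · obtain ⟨e, he⟩ := hmK
      have h1 := (tendsto_mul_cutWeight he (hw e)).const_mul |φ m|
      rw [mul_zero] at h1
      refine squeeze_zero_norm' ?_ h1
      filter_upwards [eventually_ge_atTop 0] with t ht
      have hc : ∀ x, 0 ≤ w x * t := fun x => mul_nonneg (hw x).le ht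
      have h2 : ∏ x, cutWeight K (m x) (w x * t) ≤ cutWeight K (m e) (w e * t) := by
        rw [← Finset.prod_erase_mul _ _ (Finset.mem_univ e)]
        exact mul_le_of_le_one_left (cutWeight_nonneg K _ (hc e)) (Finset.prod_le_one
          (fun x _ => cutWeight_nonneg K _ (hc x)) fun x _ => cutWeight_le_one K _ (hc x))
      rw [Real.norm_eq_abs, abs_mul, abs_mul, abs_of_nonneg ht,
        abs_of_nonneg (Finset.prod_nonneg fun x _ => cutWeight_nonneg K (m x) (hc x))]
      calc t * (|φ m| * ∏ x, cutWeight K (m x) (w x * t))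
          ≤ t * (|φ m| * cutWeight K (m e) (w e * t)) := by gcongr
        _ = _ := by ring
    · have : m = fun _ => K :=
        funext fun e => le_antisymm (mem_box.1 hm e) (by push Not at hmK; exact hmK e)
      rw [this, hφ]
      simp
  have := tendsto_finsetSum _ h
  simpa only [boxMean, Finset.mul_sum, Finset.sum_const_zero] using this

theorem tendsto_boxMean {w : E → ℝ} (hw : ∀ e, 0 < w e) {K : ℕ} {φ : (E → ℕ) → ℝ}
    (hφ : φ (fun _ => K) = 0) : Tendsto (boxMean w K φ) atTop (𝓝 0) := by
  have := tendsto_inv_atTop_zero.mul (tendsto_mul_boxMean hw hφ)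
  rw [mul_zero] at this
  refine this.congr' ?_
  filter_upwards [eventually_ne_atTop 0] with t ht
  rw [inv_mul_cancel_left₀ ht]

/-! ### Moments as integrals of the tail -/

section Moments

variable {w : E → ℝ} {K : ℕ} {A : Set (E → ℕ)} {h g : (E → ℕ) → ℝ}

open Classical in
/-- The probability that the state at time `t` is not in `A`. -/
noncomputable def tail (w : E → ℝ) (K : ℕ) (A : Set (E → ℕ)) : ℝ → ℝ :=
  boxMean w K fun m => if m ∈ A then 0 else 1

theorem tail_nonneg (hw : ∀ e, 0 < w e) {t : ℝ} (ht : 0 ≤ t) : 0 ≤ tail w K A t :=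
  boxMean_nonneg hw (fun m => by split_ifs <;> norm_num) ht

theorem tendsto_tail (hw : ∀ e, 0 < w e) (hA : IsTarget K A) :
    Tendsto (tail w K A) atTop (𝓝 0) :=
  tendsto_boxMean hw (if_pos hA.full_mem)

open Classical in
theorem IsSolution.gen_eq_ite (hA : IsTarget K A) {c : (E → ℕ) → ℝ} (hh : IsSolution w K A c h)
    (m : E → ℕ) : gen w h m = if m ∈ A then 0 else -c m := by
  split_ifs with hm
  · exact Finset.sum_eq_zero fun e _ => by
      rw [hh.eq_zero _ hm, hh.eq_zero _ (hA.addEdge_mem hm e), sub_self, mul_zero]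
  · exact hh.gen_eq m hm

theorem IsSolution.hasDerivAt_boxMean_tail (hA : IsTarget K A) (hK : 1 ≤ K)
    (hh : IsSolution w K A 1 h) (t : ℝ) : HasDerivAt (boxMean w K h) (-tail w K A t) t := by
  refine (hasDerivAt_boxMean hK hh.step t).congr_deriv ?_
  rw [← neg_one_mul, tail, ← boxMean_const_mul]
  congr 1
  funext m
  rw [hh.gen_eq_ite hA]
  split_ifs <;> simp

theorem IsSolution.hasDerivAt_boxMean_two (hA : IsTarget K A) (hK : 1 ≤ K)
    (hh : IsSolution w K A 1 h) (hg : IsSolution w K A (fun m => 2 * h m) g) (t : ℝ) :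
    HasDerivAt (boxMean w K g) (-2 * boxMean w K h t) t := by
  refine (hasDerivAt_boxMean hK hg.step t).congr_deriv ?_
  rw [← boxMean_const_mul]
  congr 1
  funext m
  rw [hg.gen_eq_ite hA]
  split_ifs with hm
  · rw [hh.eq_zero _ hm, mul_zero]
  · ring

/-- `boxMean w K h` has derivative minus the tail and runs from `h 0` to `0`. -/
theorem IsSolution.lintegral_tail (hw : ∀ e, 0 < w e) (hA : IsTarget K A) (hK : 1 ≤ K)
    (hh : IsSolution w K A 1 h) :
    ∫⁻ t in Set.Ioi 0, ENNReal.ofReal (tail w K A t) = ENNReal.ofReal (h 0) := by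
  have hd : ∀ t ∈ Set.Ici (0 : ℝ), HasDerivAt (fun t => -boxMean w K h t) (tail w K A t) t :=
    fun t _ => by simpa using (hh.hasDerivAt_boxMean_tail hA hK t).fun_neg
  have hl : Tendsto (fun t => -boxMean w K h t) atTop (𝓝 0) := by
    simpa using (tendsto_boxMean hw (hh.eq_zero _ hA.full_mem)).neg
  have hpos : ∀ t ∈ Set.Ioi (0 : ℝ), 0 ≤ tail w K A t := fun t ht => tail_nonneg hw (le_of_lt ht)
  rw [← ofReal_integral_eq_lintegral_ofReal (integrableOn_Ioi_deriv_of_nonneg' hd hpos hl)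
    (by filter_upwards [ae_restrict_mem measurableSet_Ioi] with t ht using hpos t ht),
    integral_Ioi_of_hasDerivAt_of_nonneg' hd hpos hl, boxMean_zero hK]
  simp

theorem IsSolution.lintegral_mul_tail (hw : ∀ e, 0 < w e) (hA : IsTarget K A) (hK : 1 ≤ K)
    (hh : IsSolution w K A 1 h) (hg : IsSolution w K A (fun m => 2 * h m) g) :
    ∫⁻ t in Set.Ioi 0, ENNReal.ofReal (2 * t * tail w K A t) = ENNReal.ofReal (g 0) := by
  -- With `G' = -2H` and `H' = -tail`, the derivative of `-(G + 2tH)` is `2t * tail`.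
  have hd : ∀ t ∈ Set.Ici (0 : ℝ), HasDerivAt
      (fun t => -(boxMean w K g t + 2 * (t * boxMean w K h t))) (2 * t * tail w K A t) t := by
    intro t _
    refine ((hh.hasDerivAt_boxMean_two hA hK hg t).fun_add (((hasDerivAt_id' t).fun_mul
      (hh.hasDerivAt_boxMean_tail hA hK t)).const_mul 2)).fun_neg.congr_deriv ?_
    ring
  have hl : Tendsto (fun t => -(boxMean w K g t + 2 * (t * boxMean w K h t))) atTop (𝓝 0) := by
    simpa using ((tendsto_boxMean hw (hg.eq_zero _ hA.full_mem)).add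
      ((tendsto_mul_boxMean hw (hh.eq_zero _ hA.full_mem)).const_mul 2)).neg
  have hpos : ∀ t ∈ Set.Ioi (0 : ℝ), 0 ≤ 2 * t * tail w K A t := fun t ht =>
    mul_nonneg (mul_nonneg zero_le_two (le_of_lt ht)) (tail_nonneg hw (le_of_lt ht))
  rw [← ofReal_integral_eq_lintegral_ofReal (integrableOn_Ioi_deriv_of_nonneg' hd hpos hl)
    (by filter_upwards [ae_restrict_mem measurableSet_Ioi] with t ht using hpos t ht),
    integral_Ioi_of_hasDerivAt_of_nonneg' hd hpos hl, boxMean_zero hK]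
  simp

/-- The first two moments of a random variable whose tail is that of a hitting time. -/
theorem IsSolution.moments {Ω : Type*} [MeasurableSpace Ω] {μ : Measure Ω} [IsProbabilityMeasure μ]
    (hw : ∀ e, 0 < w e) (hA : IsTarget K A) (hK : 1 ≤ K)
    (hh : IsSolution w K A 1 h) (hg : IsSolution w K A (fun m => 2 * h m) g) {X : Ω → ℝ}
    (hX : AEMeasurable X μ) (hX0 : ∀ ω, 0 ≤ X ω)
    (hlaw : ∀ t, 0 < t → μ {ω | t < X ω} = ENNReal.ofReal (tail w K A t)) :
    MemLp X 2 μ ∧ ∫ ω, X ω ∂μ = h 0 ∧ variance X μ = g 0 - h 0 ^ 2 := by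
  have hh0 : 0 ≤ h 0 := hh.nonneg hw hA (fun _ => zero_le_one) 0
  have hg0 : 0 ≤ g 0 := hg.nonneg hw hA
    (fun m => mul_nonneg zero_le_two (hh.nonneg hw hA (fun _ => zero_le_one) m)) 0
  have h1 : ∫⁻ ω, ENNReal.ofReal (X ω) ∂μ = ENNReal.ofReal (h 0) := by
    have := lintegral_rpow_eq_lintegral_meas_lt_mul μ (ae_of_all _ hX0) hX one_pos
    simp only [Real.rpow_one, sub_self, Real.rpow_zero, ENNReal.ofReal_one, mul_one, one_mul] at this
    rw [this, ← hh.lintegral_tail hw hA hK]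
    exact setLIntegral_congr_fun measurableSet_Ioi fun t ht => hlaw t ht
  have h2 : ∫⁻ ω, ENNReal.ofReal (X ω ^ 2) ∂μ = ENNReal.ofReal (g 0) := by
    have := lintegral_rpow_eq_lintegral_meas_lt_mul μ (ae_of_all _ hX0) hX two_pos
    simp only [Real.rpow_two] at this
    rw [this, ← hh.lintegral_mul_tail hw hA hK hg,
      ← lintegral_const_mul' _ _ ENNReal.ofReal_ne_top]
    refine setLIntegral_congr_fun measurableSet_Ioi fun t ht => ?_
    have ht' : (0 : ℝ) < t := ht
    have ht2 : t ^ ((2 : ℝ) - 1) = t := by norm_num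
    simp only [hlaw t ht, ht2]
    rw [ENNReal.ofReal_mul (by positivity), ENNReal.ofReal_mul zero_le_two]
    ring
  have hmem : MemLp X 2 μ := by
    rw [memLp_two_iff_integrable_sq hX.aestronglyMeasurable]
    refine ⟨(hX.pow_const 2).aestronglyMeasurable, ?_⟩
    rw [hasFiniteIntegral_iff_ofReal (ae_of_all _ fun ω => sq_nonneg _), h2]
    exact ENNReal.ofReal_lt_top
  have hm1 : ∫ ω, X ω ∂μ = h 0 := by
    rw [integral_eq_lintegral_of_nonneg_ae (ae_of_all _ hX0) hX.aestronglyMeasurable, h1,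
      ENNReal.toReal_ofReal hh0]
  have hm2 : ∫ ω, X ω ^ 2 ∂μ = g 0 := by
    rw [integral_eq_lintegral_of_nonneg_ae (ae_of_all _ fun ω => sq_nonneg _)
      (hX.pow_const 2).aestronglyMeasurable, h2, ENNReal.toReal_ofReal hg0]
  refine ⟨hmem, hm1, ?_⟩
  rw [variance_eq_sub hmem, hm1]
  simp only [Pi.pow_apply, hm2]

end Moments

end Analytic

/-! ### Spanning trees and triangles as families of edge sets -/

section Graph

variable {V : Type*} {G : SimpleGraph V}

/-- The sets of edges of `G` whose underlying set of vertex pairs satisfies `Q`. -/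
def edgeFamily (G : SimpleGraph V) (Q : Set (Sym2 V) → Prop) : Set (Finset G.edgeSet) :=
  {S | Q (Subtype.val '' (S : Set G.edgeSet))}

/-- Disjoint simple sets of edges of a multigraph correspond to packings. -/
theorem exists_disjoint_iff_mem_packs [Fintype G.edgeSet] [DecidableEq G.edgeSet]
    (Q : Set (Sym2 V) → Prop) (k : ℕ) (m : G.edgeSet → ℕ) :
    (∃ F : Fin k → Set (EdgeCopy m), (∀ i j, i ≠ j → Disjoint (F i) (F j)) ∧
      ∀ i, Set.InjOn Sigma.fst (F i) ∧ Q (support (F i))) ↔ m ∈ Packs (edgeFamily G Q) k := by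
  classical
  constructor
  · rintro ⟨F, hdisj, hF⟩
    have hmem : ∀ i e, e ∈ (Sigma.fst '' F i).toFinset ↔ ∃ j, (⟨e, j⟩ : EdgeCopy m) ∈ F i := by
      intro i e
      simp
    refine ⟨fun i => (Sigma.fst '' F i).toFinset, fun i => ?_, fun e => ?_⟩
    · have := (hF i).2
      rw [edgeFamily, Set.mem_ofPred_eq, Set.coe_toFinset, Set.image_image]
      exact this
    -- Each set using `e` owns a copy of it, and disjointness makes these copies distinct.
    · choose f hf using fun i : {i // e ∈ (Sigma.fst '' F i).toFinset} => (hmem i.1 e).1 i.2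
      rw [← Fintype.card_subtype]
      refine (Fintype.card_le_of_injective f fun i j hij => ?_).trans (Fintype.card_fin _).le
      by_contra hne
      have h1 := hf i
      rw [hij] at h1
      exact Set.disjoint_left.1 (hdisj i j fun h => hne (Subtype.ext h)) h1 (hf j)
  · rintro ⟨S, hS, hc⟩
    have hemb : ∀ e, Nonempty ({i // e ∈ S i} ↪ Fin (m e)) := fun e =>
      Function.Embedding.nonempty_of_card_le (by
        rw [Fintype.card_subtype, Fintype.card_fin]
        exact hc e)
    set f := fun e => (hemb e).some
    have hsupp : ∀ i, support {c : EdgeCopy m | ∃ h : c.1 ∈ S i, c.2 = f c.1 ⟨i, h⟩} =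
        Subtype.val '' (S i : Set G.edgeSet) := by
      intro i
      ext x
      constructor
      · rintro ⟨c, ⟨h, -⟩, rfl⟩
        exact ⟨c.1, h, rfl⟩
      · rintro ⟨e, he, rfl⟩
        exact ⟨⟨e, f e ⟨i, he⟩⟩, ⟨he, rfl⟩, rfl⟩
    refine ⟨fun i => {c | ∃ h : c.1 ∈ S i, c.2 = f c.1 ⟨i, h⟩}, fun i j hij => ?_, fun i => ⟨?_, ?_⟩⟩
    · rw [Set.disjoint_left]
      rintro ⟨e, c⟩ ⟨hi, hci⟩ ⟨hj, hcj⟩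
      have := (f e).injective (hci.symm.trans hcj)
      exact hij (congrArg Subtype.val this)
    · rintro ⟨e, c⟩ ⟨h, hc⟩ ⟨e', c'⟩ ⟨h', hc'⟩ hee
      obtain rfl : e = e' := hee
      obtain rfl : c = c' := hc.trans hc'.symm
      rfl
    · rw [hsupp]
      exact hS i

open Classical in
/-- The edges of `G` that cross the boundary of a set of vertices which is neither empty nor
everything. -/
def cuts (G : SimpleGraph V) [Fintype G.edgeSet] : Set (Finset G.edgeSet) :=
  {C | ∃ U : Set V, U.Nonempty ∧ Uᶜ.Nonempty ∧
    C = Finset.univ.filter fun e : G.edgeSet => ∃ u v, u ∈ U ∧ v ∉ U ∧ (e : Sym2 V) = s(u, v)}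

/-- The spanning trees of `G`. -/
abbrev spanningTrees (G : SimpleGraph V) : Set (Finset G.edgeSet) :=
  edgeFamily G fun s => (SimpleGraph.fromEdgeSet s).IsTree

/-- The triangles of `G`. -/
abbrev triangles (G : SimpleGraph V) : Set (Finset G.edgeSet) :=
  edgeFamily G fun s =>
    ∃ a b c : V, a ≠ b ∧ b ≠ c ∧ a ≠ c ∧ s = {s(a, b), s(b, c), s(a, c)}

theorem fromEdgeSet_image_adj {S : Finset G.edgeSet} {u v : V} :
    (SimpleGraph.fromEdgeSet (Subtype.val '' (S : Set G.edgeSet))).Adj u v ↔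
      ∃ e ∈ S, (e : Sym2 V) = s(u, v) := by
  rw [SimpleGraph.fromEdgeSet_adj]
  constructor
  · rintro ⟨⟨e, he, hes⟩, -⟩
    exact ⟨e, he, hes⟩
  · rintro ⟨e, he, hes⟩
    refine ⟨⟨e, he, hes⟩, ?_⟩
    have := e.2
    rw [hes] at this
    exact G.ne_of_adj this

theorem spanningTrees_nonempty [Fintype G.edgeSet] (hG : G.Connected) :
    (spanningTrees G).Nonempty := by
  classical
  obtain ⟨T, hT, htree⟩ := hG.exists_isTree_le
  refine ⟨Finset.univ.filter fun e : G.edgeSet => (e : Sym2 V) ∈ T.edgeSet, ?_⟩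
  have : Subtype.val '' ((Finset.univ.filter fun e : G.edgeSet => (e : Sym2 V) ∈ T.edgeSet :
      Finset G.edgeSet) : Set G.edgeSet) = T.edgeSet := by
    ext x
    constructor
    · rintro ⟨e, he, rfl⟩
      simpa using he
    · intro hx
      exact ⟨⟨x, SimpleGraph.edgeSet_mono hT hx⟩, by simpa using hx, rfl⟩
  change (SimpleGraph.fromEdgeSet _).IsTree
  rw [this, SimpleGraph.fromEdgeSet_edgeSet]
  exact htree

theorem spanningTrees_meet_cuts [Fintype G.edgeSet] {C : Finset G.edgeSet} (hC : C ∈ cuts G)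
    {S : Finset G.edgeSet} (hS : S ∈ spanningTrees G) : ∃ e ∈ S, e ∈ C := by
  obtain ⟨U, ⟨u, hu⟩, ⟨v, hv⟩, rfl⟩ := hC
  obtain ⟨p⟩ := hS.connected.preconnected u v
  obtain ⟨d, -, hd1, hd2⟩ := p.exists_boundary_dart U hu hv
  obtain ⟨e, he, hes⟩ := fromEdgeSet_image_adj.1 d.adj
  exact ⟨e, he, by simpa using ⟨_, hd1, _, hd2, hes⟩⟩

/-- Deleting `e` splits the tree into two components; an edge between them reconnects the forest and
closes no cycle. -/
theorem spanningTrees_exchange [Fintype G.edgeSet] [DecidableEq G.edgeSet] {S : Finset G.edgeSet}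
    (hS : S ∈ spanningTrees G) {e : G.edgeSet} (he : e ∈ S) :
    ∃ C ∈ cuts G, ∀ e' ∈ C, insert e' (S.erase e) ∈ spanningTrees G := by
  classical
  obtain ⟨⟨u, v⟩, huv⟩ := e
  set T := SimpleGraph.fromEdgeSet (Subtype.val '' (S : Set G.edgeSet)) with hT
  have hTtree : T.IsTree := hS
  set D := T.deleteEdges {s(u, v)} with hD
  have hadj : T.Adj u v := fromEdgeSet_image_adj.2 ⟨_, he, rfl⟩
  have hDv : ¬ D.Reachable u v :=
    SimpleGraph.isAcyclic_iff_forall_adj_isBridge.1 hTtree.isAcyclic hadj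
  have hDT : ∀ {a b}, T.Adj a b → D.Adj a b ∨ s(a, b) = s(u, v) := by
    intro a b hab
    by_cases h : s(a, b) = s(u, v)
    · exact Or.inr h
    · exact Or.inl (SimpleGraph.deleteEdges_adj.2 ⟨hab, h⟩)
  have hcover : ∀ z, D.Reachable u z ∨ D.Reachable v z := by
    intro z
    by_contra hz
    push Not at hz
    obtain ⟨p⟩ := hTtree.connected.preconnected u z
    obtain ⟨d, -, hd1, hd2⟩ := p.exists_boundary_dart {x | D.Reachable u x ∨ D.Reachable v x}
      (Or.inl (SimpleGraph.Reachable.refl _)) (by simpa using hz)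
    simp only [Set.mem_ofPred_eq, not_or] at hd1 hd2
    rcases hDT d.adj with h | h
    · exact hd1.elim (fun h1 => hd2.1 (h1.trans h.reachable)) fun h1 => hd2.2 (h1.trans h.reachable)
    · rcases Sym2.eq_iff.1 h with ⟨-, h⟩ | ⟨-, h⟩
      · exact hd2.2 (h ▸ SimpleGraph.Reachable.refl _)
      · exact hd2.1 (h ▸ SimpleGraph.Reachable.refl _)
  refine ⟨_, ⟨{x | D.Reachable u x}, ⟨u, SimpleGraph.Reachable.refl _⟩, ⟨v, hDv⟩, rfl⟩, ?_⟩
  intro e' he'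
  obtain ⟨x, y, hx, hy, hxy⟩ := (Finset.mem_filter.1 he').2
  have hne : x ≠ y := by
    rintro rfl
    exact hy hx
  have hT' : SimpleGraph.fromEdgeSet (Subtype.val ''
      ((insert e' (S.erase ⟨s(u, v), huv⟩) : Finset G.edgeSet) : Set G.edgeSet)) =
      D ⊔ SimpleGraph.edge x y := by
    ext a b
    rw [fromEdgeSet_image_adj, SimpleGraph.sup_adj, hD, SimpleGraph.deleteEdges_adj, hT,
      fromEdgeSet_image_adj, SimpleGraph.edge, SimpleGraph.fromEdgeSet_adj]
    constructor
    · rintro ⟨e, he, hes⟩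
      rcases Finset.mem_insert.1 he with rfl | he
      · right
        refine ⟨hes.symm.trans hxy, ?_⟩
        have := e.2
        rw [hes] at this
        exact G.ne_of_adj this
      · left
        obtain ⟨h1, h2⟩ := Finset.mem_erase.1 he
        exact ⟨⟨e, h2, hes⟩, fun h => h1 (Subtype.ext (hes.trans h))⟩
    · rintro (⟨⟨e, he, hes⟩, h⟩ | ⟨h, -⟩)
      · refine ⟨e, Finset.mem_insert_of_mem (Finset.mem_erase.2 ⟨?_, he⟩), hes⟩
        rintro rfl
        exact h hes.symm
      · exact ⟨e', Finset.mem_insert_self _ _, hxy.trans h.symm⟩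
  change (SimpleGraph.fromEdgeSet _).IsTree
  rw [hT']
  have hnr : ¬ D.Reachable x y := fun h => hy (SimpleGraph.Reachable.trans hx h)
  have hDacyc : D.IsAcyclic := hTtree.isAcyclic.anti (SimpleGraph.deleteEdges_le _)
  refine ⟨?_, hDacyc.sup_edge_of_not_reachable hnr⟩
  have hle : D ≤ D ⊔ SimpleGraph.edge x y := le_sup_left
  have huy : (D ⊔ SimpleGraph.edge x y).Reachable u y :=
    (SimpleGraph.Reachable.mono hle hx).trans (SimpleGraph.Adj.reachable
      (Or.inr (by rw [SimpleGraph.edge_adj]; simp [hne])))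
  have hall : ∀ z, (D ⊔ SimpleGraph.edge x y).Reachable u z := by
    intro z
    rcases hcover z with h | h
    · exact h.mono hle
    · have hvy : D.Reachable v y := (hcover y).resolve_left hy
      exact huy.trans ((hvy.symm.trans h).mono hle)
  have : Nonempty V := ⟨u⟩
  exact ⟨fun a b => (hall a).symm.trans (hall b)⟩

theorem spanningTrees_elem_nonempty [Fintype G.edgeSet] [Nontrivial V] {S : Finset G.edgeSet}
    (hS : S ∈ spanningTrees G) : S.Nonempty := by
  obtain ⟨u, v, huv⟩ := exists_pair_ne V
  obtain ⟨e, he, -⟩ := spanningTrees_meet_cuts ⟨{u}, ⟨u, rfl⟩, ⟨v, fun h => huv h.symm⟩, rfl⟩ hS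
  exact ⟨e, he⟩

theorem card_of_mem_triangles {S : Finset G.edgeSet} (hS : S ∈ triangles G) : S.card = 3 := by
  obtain ⟨a, b, c, hab, hbc, hac, h⟩ := hS
  rw [← Set.ncard_coe_finset, ← Set.ncard_image_of_injective _ Subtype.val_injective, h,
    Set.ncard_eq_three]
  refine ⟨_, _, _, ?_, ?_, ?_, rfl⟩ <;> simp <;> grind

theorem triangles_nonempty [Fintype G.edgeSet]
    (h : ∃ a b c : V, G.Adj a b ∧ G.Adj b c ∧ G.Adj a c) : (triangles G).Nonempty := by
  classical
  obtain ⟨a, b, c, hab, hbc, hac⟩ := h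
  refine ⟨{⟨s(a, b), hab⟩, ⟨s(b, c), hbc⟩, ⟨s(a, c), hac⟩}, a, b, c, hab.ne, hbc.ne, hac.ne, ?_⟩
  simp [Set.image_insert_eq]

end Graph

/-! ### Law of the hitting times of the process -/

section HittingTime

open Filter Topology

theorem IsPoissonProcess.hasLaw {Ω : Type*} [MeasurableSpace Ω] {μ : Measure Ω}
    {N : ℝ≥0 → Ω → ℕ} {r : ℝ≥0} (hN : IsPoissonProcess N r μ) (t : ℝ≥0) :
    HasLaw (N t) (poissonMeasure (r * t)) μ := by
  have h := hN.incrementLaw 0 t (zero_le)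
  rw [tsub_zero] at h
  refine h.congr ?_
  filter_upwards [hN.zero] with ω hω
  simp [hω]

theorem poissonMeasure_min_eq {K a : ℕ} (ha : a ≤ K) (r : ℝ≥0) :
    poissonMeasure r {n | min n K = a} = ENNReal.ofReal (cutWeight K a r) := by
  have hs : ∀ b, poissonMeasure r {b} = ENNReal.ofReal (poissonWeight b r) :=
    poissonMeasure_singleton r
  rcases ha.lt_or_eq with h | rfl
  · have : {n | min n K = a} = {a} := by
      ext n
      simp only [Set.mem_ofPred_eq, Set.mem_singleton_iff]
      omega
    rw [this, hs, cutWeight, if_pos h]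
  · have : {n | min n a = a} = ((Finset.range a : Finset ℕ) : Set ℕ)ᶜ := by
      ext n
      simp
    rw [this, prob_compl_eq_one_sub (Finset.measurableSet _), cutWeight, if_neg (lt_irrefl _),
      ← sum_measure_singleton, ENNReal.ofReal_sub _ (Finset.sum_nonneg fun b _ =>
        poissonWeight_nonneg b r.coe_nonneg), ENNReal.ofReal_one, ENNReal.ofReal_sum_of_nonneg
        fun b _ => poissonWeight_nonneg b r.coe_nonneg]
    simp only [hs]

variable {V Ω : Type*} [MeasurableSpace Ω] {μ : Measure Ω} {G : SimpleGraph V}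
  {w : G.edgeSet → ℝ≥0} {N : G.edgeSet → ℝ≥0 → Ω → ℕ}

section Law

variable [Fintype G.edgeSet] [DecidableEq G.edgeSet]

theorem IsMultigraphProcess.measurable_state (hN : IsMultigraphProcess G w N μ) (t : ℝ≥0) :
    Measurable fun ω e => N e t ω :=
  measurable_pi_iff.2 fun e => (hN.poisson e).measurable t

theorem IsMultigraphProcess.measure_trunc_eq [IsProbabilityMeasure μ]
    (hN : IsMultigraphProcess G w N μ)
    (t : ℝ≥0) {K : ℕ} {m : G.edgeSet → ℕ} (hm : m ∈ box G.edgeSet K) :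
    μ {ω | trunc K (fun e => N e t ω) = m} =
      ENNReal.ofReal (∏ e, cutWeight K (m e) ((w e : ℝ) * t)) := by
  have hind : iIndepFun (fun e ω => N e t ω) μ :=
    hN.indep.comp (fun _ f => f t) fun _ => measurable_pi_apply t
  have h1 : {ω | trunc K (fun e => N e t ω) = m} =
      ⋂ e ∈ (Finset.univ : Finset G.edgeSet), (fun ω => N e t ω) ⁻¹' {n | min n K = m e} := by
    ext ω
    simp [funext_iff, trunc]
  rw [h1, hind.measure_inter_preimage_eq_mul Finset.univ (fun e _ => .of_discrete),
    ENNReal.ofReal_prod_of_nonneg fun e _ => cutWeight_nonneg K _ (by positivity)]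
  refine Finset.prod_congr rfl fun e _ => ?_
  rw [← Measure.map_apply ((hN.poisson e).measurable t) .of_discrete,
    ((hN.poisson e).hasLaw t).map_eq, poissonMeasure_min_eq (mem_box.1 hm e)]
  simp

theorem IsMultigraphProcess.measure_notMem [IsProbabilityMeasure μ]
    (hN : IsMultigraphProcess G w N μ) {K : ℕ}
    {A : Set (G.edgeSet → ℕ)} (hA : IsTarget K A) (t : ℝ≥0) :
    μ {ω | (fun e => N e t ω) ∉ A} = ENNReal.ofReal (tail (fun e => (w e : ℝ)) K A t) := by
  classical
  have h1 : {ω | (fun e => N e t ω) ∉ A} =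
      ⋃ m ∈ (box G.edgeSet K).filter (· ∉ A), {ω | trunc K (fun e => N e t ω) = m} := by
    ext ω
    simp only [Set.mem_ofPred_eq, Set.mem_iUnion, exists_prop, exists_eq_right', Finset.mem_filter,
      mem_box, hA.trunc_mem_iff]
    exact ⟨fun h => ⟨fun e => min_le_right _ _, h⟩, fun h => h.2⟩
  have htm : Measurable fun ω => trunc K (fun e => N e t ω) :=
    measurable_pi_iff.2 fun e => ((hN.poisson e).measurable t).min measurable_const
  rw [h1, measure_biUnion_finset (f := fun m => {ω | trunc K (fun e => N e t ω) = m}) (fun m _ m' _ hne => Set.disjoint_left.2 fun ω h h' =>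
    hne (h.symm.trans h')) (fun m _ => htm (measurableSet_singleton m)),
    Finset.sum_congr rfl fun m hm => hN.measure_trunc_eq t (Finset.mem_filter.1 hm).1,
    ← ENNReal.ofReal_sum_of_nonneg fun m _ => Finset.prod_nonneg fun e _ =>
      cutWeight_nonneg K _ (by positivity), tail, boxMean, Finset.sum_filter]
  congr 1
  refine Finset.sum_congr rfl fun m _ => ?_
  split_ifs <;> simp_all

/-- A right-continuous integer path is constant just after `t`, so a state outside `A` stays outside
for a while; monotonicity rules out earlier visits. -/
theorem lt_hittingTime_iff {A : Set (G.edgeSet → ℕ)} (hA : IsUpperSet A) {ω : Ω}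
    (hmono : ∀ e, Monotone fun t => N e t ω)
    (hcont : ∀ e t, ContinuousWithinAt (fun s => N e s ω) (Set.Ici t) t) (t : ℝ≥0) :
    (t : ℝ≥0∞) < hittingTime (· ∈ A) N ω ↔ (fun e => N e t ω) ∉ A := by
  refine ⟨fun h hmem => not_le.2 h (iInf₂_le t hmem), fun h => ?_⟩
  have h1 : ∀ᶠ s in 𝓝[≥] t, ∀ e, N e s ω = N e t ω := by
    rw [eventually_all]
    intro e
    have := hcont e t
    rw [ContinuousWithinAt, nhds_discrete, tendsto_pure] at this
    exact this
  have h2 : ∀ᶠ s in 𝓝[>] t, ∀ e, N e s ω = N e t ω :=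
    h1.filter_mono (nhdsWithin_mono _ Set.Ioi_subset_Ici_self)
  obtain ⟨s, hs, hts⟩ := (h2.and self_mem_nhdsWithin).exists
  have hts' : t < s := hts
  refine lt_of_lt_of_le (ENNReal.coe_lt_coe.2 hts') (le_iInf₂ fun r hr => ?_)
  by_contra! hrs
  refine h (hA (fun e => ?_) hr)
  rw [← hs e]
  exact hmono e (ENNReal.coe_le_coe.1 hrs.le)

/-- Along monotone paths the infimum may be taken over rational times. -/
theorem IsMultigraphProcess.aemeasurable_hittingTime (hN : IsMultigraphProcess G w N μ)
    {A : Set (G.edgeSet → ℕ)} (hA : IsUpperSet A) :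
    AEMeasurable (hittingTime (· ∈ A) N) μ := by
  classical
  refine ⟨fun ω => ⨅ q : ℚ, if (fun e => N e (Real.toNNReal q) ω) ∈ A then
    ((Real.toNNReal q : ℝ≥0) : ℝ≥0∞) else ∞, ?_, ?_⟩
  · exact Measurable.iInf fun q => Measurable.ite
      ((hN.measurable_state _) (MeasurableSet.of_discrete (s := A)))
      measurable_const measurable_const
  · filter_upwards [ae_all_iff.2 fun e => (hN.poisson e).mono] with ω hmono
    apply le_antisymm
    · refine le_iInf fun q => ?_
      split_ifs with h
      · exact iInf₂_le (Real.toNNReal q) h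
      · exact le_top
    · refine le_iInf₂ fun t ht => ENNReal.le_of_forall_pos_le_add fun ε hε _ => ?_
      obtain ⟨q, hq1, hq2⟩ := exists_rat_btwn
        (show (t : ℝ) < ((t + ε : ℝ≥0) : ℝ) by push_cast; simpa using hε)
      have hle : t ≤ Real.toNNReal q := NNReal.le_toNNReal_of_coe_le hq1.le
      refine iInf_le_of_le q ?_
      rw [if_pos (hA (fun e => hmono e hle) ht), ← ENNReal.coe_add, ENNReal.coe_le_coe]
      exact Real.toNNReal_le_iff_le_coe.2 hq2.le

/-- The moments of a hitting time in terms of the first-step equations. -/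
theorem IsMultigraphProcess.hittingTime_moments [IsProbabilityMeasure μ]
    (hN : IsMultigraphProcess G w N μ) (hw : ∀ e, 0 < w e) {K : ℕ} (hK : 1 ≤ K)
    {A : Set (G.edgeSet → ℕ)} (hA : IsTarget K A) {h g : (G.edgeSet → ℕ) → ℝ}
    (hh : IsSolution (fun e => (w e : ℝ)) K A 1 h)
    (hg : IsSolution (fun e => (w e : ℝ)) K A (fun m => 2 * h m) g) :
    (∀ᵐ ω ∂μ, hittingTime (· ∈ A) N ω ≠ ∞) ∧
      MemLp (fun ω => (hittingTime (· ∈ A) N ω).toReal) 2 μ ∧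
      mean (hittingTime (· ∈ A) N) μ = h 0 ∧
      stdDev (hittingTime (· ∈ A) N) μ = √(g 0 - h 0 ^ 2) := by
  have hw' : ∀ e, (0 : ℝ) < w e := fun e => hw e
  have hlt : ∀ᵐ ω ∂μ, ∀ t : ℝ≥0,
      (t : ℝ≥0∞) < hittingTime (· ∈ A) N ω ↔ (fun e => N e t ω) ∉ A := by
    filter_upwards [ae_all_iff.2 fun e => (hN.poisson e).mono,
      ae_all_iff.2 fun e => (hN.poisson e).rightCont] with ω h1 h2
    exact lt_hittingTime_iff hA.upper h1 h2
  have hfin : ∀ᵐ ω ∂μ, hittingTime (· ∈ A) N ω ≠ ∞ := by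
    -- An infinite hitting time means being outside `A` at every time `n`, an event whose
    -- probability tends to `0`.
    have hle : ∀ n : ℕ, μ {ω | ¬ hittingTime (· ∈ A) N ω ≠ ∞} ≤
        ENNReal.ofReal (tail (fun e => (w e : ℝ)) K A n) := by
      intro n
      have h1 := hN.measure_notMem hA (n : ℝ≥0)
      rw [NNReal.coe_natCast] at h1
      rw [← h1]
      refine measure_mono_ae ?_
      filter_upwards [hlt] with ω hω htop
      have htop' : ¬ hittingTime (· ∈ A) N ω ≠ ∞ := htop
      rw [ne_eq, not_not] at htop'
      exact (hω n).1 (htop' ▸ ENNReal.coe_lt_top)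
    have hlim : Tendsto (fun n : ℕ => ENNReal.ofReal (tail (fun e => (w e : ℝ)) K A n)) atTop
        (𝓝 0) := by
      have := ENNReal.tendsto_ofReal ((tendsto_tail hw' hA).comp tendsto_natCast_atTop_atTop)
      simpa using this
    exact le_antisymm (ge_of_tendsto' hlim hle) zero_le
  have hmom := IsSolution.moments hw' hA hK hh hg
    (hN.aemeasurable_hittingTime hA.upper).ennreal_toReal (fun ω => ENNReal.toReal_nonneg)
    fun t ht => by
      have h1 := hN.measure_notMem hA t.toNNReal
      rw [Real.coe_toNNReal t ht.le] at h1
      rw [← h1]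
      refine measure_congr ?_
      filter_upwards [hlt, hfin] with ω hω hne
      exact propext ((ENNReal.ofReal_lt_iff_lt_toReal ht.le hne).symm.trans (hω _))
  refine ⟨hfin, hmom.1, hmom.2.1, ?_⟩
  rw [stdDev, hmom.2.2]

/-- A hitting time whose mean is lowered by at most `κ` by each arrival has a coefficient of
variation of at most `√(κ / h 0)`, where `h 0` is its mean. -/
theorem IsMultigraphProcess.hittingTime_concentration [IsProbabilityMeasure μ]
    (hN : IsMultigraphProcess G w N μ) (hw : ∀ e, 0 < w e) {K : ℕ} (hK : 1 ≤ K)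
    {A : Set (G.edgeSet → ℕ)} (hA : IsTarget K A) (hA0 : 0 ∉ A) {h : (G.edgeSet → ℕ) → ℝ}
    (hh : IsSolution (fun e => (w e : ℝ)) K A 1 h) {κ : ℝ}
    (hκ : ∀ m e, h m - h (addEdge m e) ≤ κ) {b : ℝ} (hb0 : 0 ≤ b) (hb : κ ≤ b ^ 2 * h 0) :
    (∀ᵐ ω ∂μ, hittingTime (· ∈ A) N ω ≠ ∞) ∧
      MemLp (fun ω => (hittingTime (· ∈ A) N ω).toReal) 2 μ ∧
      0 < mean (hittingTime (· ∈ A) N) μ ∧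
      stdDev (hittingTime (· ∈ A) N) μ / mean (hittingTime (· ∈ A) N) μ ≤ b := by
  have hw' : ∀ e, (0 : ℝ) < w e := fun e => hw e
  obtain ⟨g, hg⟩ := exists_isSolution hw' hA (c := fun m => 2 * h m) fun m => by rw [hh.trunc]
  obtain ⟨h1, h2, h3, h4⟩ := hN.hittingTime_moments hw hK hA hh hg
  have hpos := hh.pos_of_notMem hw' hA hA0
  refine ⟨h1, h2, by rwa [h3], ?_⟩
  rw [h3, h4, div_le_iff₀ hpos]
  refine Real.sqrt_le_iff.2 ⟨mul_nonneg hb0 hpos.le, ?_⟩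
  calc g 0 - h 0 ^ 2 ≤ κ * h 0 := hh.variance_le hw' hA hg hκ 0
    _ ≤ b ^ 2 * h 0 * h 0 := mul_le_mul_of_nonneg_right hb hpos.le
    _ = (b * h 0) ^ 2 := by ring

end Law

end HittingTime

end MultigraphProcess

/-! ### The two concentration bounds -/

open MultigraphProcess in
theorem mainTheorem5 {V Ω : Type*} [Finite V] [Nontrivial V] [MeasurableSpace Ω]
    (μ : Measure Ω) [IsProbabilityMeasure μ]
    (G : SimpleGraph V) (hG : G.Connected)
    (w : G.edgeSet → ℝ≥0) (hw : ∀ e, 0 < w e)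
    (N : G.edgeSet → ℝ≥0 → Ω → ℕ) (hN : MultigraphProcess.IsMultigraphProcess G w N μ)
    (k : ℕ) (hk : 1 ≤ k) :
    ((∀ᵐ ω ∂μ, MultigraphProcess.spanTime k N ω ≠ ∞) ∧
      MemLp (fun ω => (MultigraphProcess.spanTime k N ω).toReal) 2 μ ∧
      0 < MultigraphProcess.mean (MultigraphProcess.spanTime k N) μ ∧
      MultigraphProcess.stdDev (MultigraphProcess.spanTime k N) μ /
          MultigraphProcess.mean (MultigraphProcess.spanTime k N) μ
        ≤ 1 / √(k : ℝ)) ∧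
    ((∃ a b c : V, G.Adj a b ∧ G.Adj b c ∧ G.Adj a c) →
      (∀ᵐ ω ∂μ, MultigraphProcess.triaTime k N ω ≠ ∞) ∧
      MemLp (fun ω => (MultigraphProcess.triaTime k N ω).toReal) 2 μ ∧
      0 < MultigraphProcess.mean (MultigraphProcess.triaTime k N) μ ∧
      MultigraphProcess.stdDev (MultigraphProcess.triaTime k N) μ /
          MultigraphProcess.mean (MultigraphProcess.triaTime k N) μ
        ≤ (Real.exp 1 / (Real.exp 1 - 1)) ^ (1 / 2 : ℝ) * (k : ℝ) ^ (-(1 / 6) : ℝ)) := by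
  classical
  have := Fintype.ofFinite G.edgeSet
  have hw' : ∀ e, (0 : ℝ) < w e := fun e => hw e
  have hk0 : (0 : ℝ) < k := by exact_mod_cast hk
  constructor
  · have hspan : spanTime k N = hittingTime (· ∈ Packs (spanningTrees G) k) N := by
      unfold spanTime
      congr 1
      funext m
      exact propext (exists_disjoint_iff_mem_packs (fun s => (SimpleGraph.fromEdgeSet s).IsTree) k m)
    have hne := spanningTrees_nonempty hG
    have hA := isTarget_packs (k := k) hne le_rfl
    obtain ⟨h, hh⟩ := exists_isSolution hw' hA (c := 1) fun _ => rfl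
    have hκ := sub_addEdge_le_of_exchange hw' hne hk hh (fun S hS e he => spanningTrees_exchange hS he)
      (fun C hC S hS => spanningTrees_meet_cuts hC hS)
    rw [hspan]
    refine hN.hittingTime_concentration hw hk hA
      (zero_notMem_packs (fun S hS => spanningTrees_elem_nonempty hS) hk) hh hκ (by positivity) ?_
    rw [div_pow, Real.sq_sqrt hk0.le, one_pow, one_div, inv_mul_eq_div]
  · intro htri
    have htria : triaTime k N = hittingTime (· ∈ Packs (triangles G) k) N := by
      unfold triaTime
      congr 1
      funext m
      exact propext (exists_disjoint_iff_mem_packs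
        (fun s => ∃ a b c : V, a ≠ b ∧ b ≠ c ∧ a ≠ c ∧ s = {s(a, b), s(b, c), s(a, c)}) k m)
    have hne := triangles_nonempty htri
    have hA₁ := isTarget_packs (k := 1) hne hk
    have hA := isTarget_packs (k := k) hne le_rfl
    obtain ⟨h₁, hh₁⟩ := exists_isSolution hw' hA₁ (c := 1) fun _ => rfl
    obtain ⟨h, hh⟩ := exists_isSolution hw' hA (c := 1) fun _ => rfl
    have hκ := sub_addEdge_le_solution_one hw' hne hk le_rfl hh₁ hh
    have hcard : ∀ S ∈ triangles G, S.card = 3 := fun S hS => card_of_mem_triangles hS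
    have he : 1 < Real.exp 1 := Real.one_lt_exp_iff.2 one_pos
    have hc : 0 < Real.exp 1 / (Real.exp 1 - 1) := div_pos (by linarith) (by linarith)
    rw [htria]
    refine hN.hittingTime_concentration hw hk hA
      (zero_notMem_packs (fun S hS => Finset.card_pos.1 (by rw [hcard S hS]; norm_num)) hk) hh hκ
      (by positivity) ?_
    -- The retention probability `k ^ (-1/3)` lets each triangle survive with probability `1 / k`,
    -- about one survivor among `k`.
    have hp3 : ((k : ℝ) ^ (-(1 / 3) : ℝ)) ^ 3 = 1 / k := by
      rw [← Real.rpow_natCast, ← Real.rpow_mul hk0.le]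
      norm_num [Real.rpow_neg_one]
    have hb : ((Real.exp 1 / (Real.exp 1 - 1)) ^ (1 / 2 : ℝ) * (k : ℝ) ^ (-(1 / 6) : ℝ)) ^ 2 =
        Real.exp 1 / (Real.exp 1 - 1) * (k : ℝ) ^ (-(1 / 3) : ℝ) := by
      rw [mul_pow, ← Real.rpow_natCast, ← Real.rpow_natCast, ← Real.rpow_mul hc.le,
        ← Real.rpow_mul hk0.le]
      norm_num
    have hmain := mul_solution_one_le hw' hne hcard hk le_rfl hh₁ hh
      (Real.rpow_pos_of_pos hk0 (-(1 / 3)))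
      (Real.rpow_le_one_of_one_le_of_nonpos (by exact_mod_cast hk) (by norm_num))
    rw [hp3] at hmain
    -- `(1 - 1/k)^k ≤ exp (-1)` is the source of the constant `e / (e - 1)`.
    have hexp := Real.one_sub_div_pow_le_exp_neg (n := k) (t := 1) (by exact_mod_cast hk)
    have h₁0 := hh₁.nonneg hw' hA₁ (fun _ => zero_le_one) 0
    have h2 : (1 - Real.exp (-1)) * h₁ 0 ≤ (k : ℝ) ^ (-(1 / 3) : ℝ) * h 0 :=
      le_trans (mul_le_mul_of_nonneg_right (by linarith) h₁0) hmain
    have h3 : Real.exp 1 / (Real.exp 1 - 1) * (1 - Real.exp (-1)) = 1 := by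
      have : Real.exp 1 - 1 ≠ 0 := by linarith
      rw [Real.exp_neg]
      field_simp
    rw [hb, mul_assoc]
    calc h₁ 0 = Real.exp 1 / (Real.exp 1 - 1) * ((1 - Real.exp (-1)) * h₁ 0) := by
          rw [← mul_assoc, h3, one_mul]
      _ ≤ _ := mul_le_mul_of_nonneg_left h2 hc.le
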